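/- Let $K$ be a field that is complete for an ultrametric absolute value $|\cdot|$, with infinite residue field, and whose value group $|K^*|$ is not discrete (equivalently, is dense in $\mathbb{R}_{>0}$). **Balls of $K$ and $\mathbb{P}^1_K$.** For $a\in K$ and $r\in|K^*|$, the sets $\{|z-a|<r\}$ and $\{|z-a|\le r\}$ are an open and a closed ball of $K$; for $r>0$, $r\notin|K^*|$, they coincide and form an irrational ball of $K$. Identify $K$ with $\mathbb{P}^1_K\setminus\{\infty\}$. An open (resp. closed, irrational) ball of $\mathbb{P}^1_K$ is a ball of $K$ of the same kind or the complement in $\mathbb{P}^1_K$ of a closed (resp. open, irrational) ball of $K$. An open affinoid is a finite intersection of open balls of $\mathbb{P}^1_K$ (the empty intersection being $\mathbb{P}^1_K$). **The compactification $\mathbb{A}^1_K$.** Give $\mathbb{P}^1_K$ the uniform structure whose entourages are the sets containing $\bigcup_{Y\in C}Y\times Y$ for some finite covering $C$ of $\mathbb{P}^1_K$ by open affinoids. Let $\mathbb{A}^1_K$ be its Hausdorff completion, i.e. the set of minimal Cauchy filters on $\mathbb{P}^1_K$ with its uniform structure; a point $x\in\mathbb{P}^1_K$ is identified with its filter of neighbourhoods.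 For $\mathcal{F}\in\mathbb{A}^1_K$ let $B_{\mathcal F}$ be the intersection of all balls of $K$ (open, closed or irrational) that belong to $\mathcal F$. The open balls of $\mathbb{A}^1_K$ are the sets $\widehat B=\{\mathcal F : B\in\mathcal F\}$ for $B$ an open or irrational ball of $\mathbb{P}^1_K$; the closed balls of $\mathbb{A}^1_K$ are the closures $\overline B$ in $\mathbb{A}^1_K$ of the closed or irrational balls $B$ of $\mathbb{P}^1_K$. **The tree.** Let $A_K^{\mathbb R}$ be the quotient of $K\times[0,\infty)$ by $(x,r)\sim(x',r')\iff r=r'\ge|x-x'|$, and write $[x,r]$ for the class of $(x,r)$. Put $B_{[x,r]}=\{w\in K:|w-x|\le r\}$, $\operatorname{diam}[x,r]=r$, $|[x,r]|=\max\{|x|,r\}$, $\sup\{[x,r],[x',r']\}=\max\{r,r',|x-x'|\}$ and $\delta(S,S')=\sup\{S,S'\}-\tfrac12(\operatorname{diam}S+\operatorname{diam}S')$. Then $\delta$ is a distance; identify $x\in K$ with $[x,0]$. Let $A_K$ be the completion of $(A_K^{\mathbb R},\delta)$, to which $\operatorname{diam}$, $|\cdot|$ and $\sup$ extend by continuity.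 With $h(S)=\max\{1,|S|\}$, put $\widehat A_K=A_K\sqcup\{\infty\}$ with the distance $$\Delta(S,S')=\frac{\sup\{S,S'\}}{h(S)h(S')}-\frac{\operatorname{diam}S}{2h(S)^2}-\frac{\operatorname{diam}S'}{2h(S')^2},\qquad \Delta(S,\infty)=\frac1{h(S)}-\frac{\operatorname{diam}S}{2h(S)^2}\qquad(S,S'\in A_K).$$ The open (resp. closed) balls of $A_K$ are the sets $\{S:\sup\{x,S\}<r\}$ (resp. $\le r$) with $x\in K$, $r>0$; an open (resp. closed) ball of $\widehat A_K$ is an open (resp. closed) ball of $A_K$ or the complement in $\widehat A_K$ of a closed (resp. open) ball of $A_K$. Identify $\mathbb{P}^1_K$ with $K\sqcup\{\infty\}\subset\widehat A_K$. **Theorem.** For each $S\in A_K^{\mathbb R}\setminus K$ there is a unique $\iota(S)\in\mathbb{A}^1_K$ such that $B_{\iota(S)}=B_S$, and the following hold. 1. The map $\iota:A_K^{\mathbb R}\setminus K\to\mathbb{A}^1_K$ extends to a uniformly continuous bijection, again denoted $\iota$, from $(\widehat A_K,\Delta)$ onto the uniform space $\mathbb{A}^1_K$. 2. The map $D\mapsto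 D\cap\mathbb{P}^1_K$ is a bijection from the open (resp. closed) balls of $\widehat A_K$ onto the open or irrational (resp. closed or irrational) balls of $\mathbb{P}^1_K$. For an open (resp. closed) ball $D$ of $\widehat A_K$ and the corresponding ball $B=D\cap\mathbb{P}^1_K$, one has $\iota(D)=\widehat B$ (resp. $\iota(D)=\overline B$). In particular $\iota$ carries the open (resp. closed) balls of $\widehat A_K$ exactly onto the open (resp. closed) balls of $\mathbb{A}^1_K$. -/

import Mathlib

open Set Filter Topology Uniformity
open scoped NNReal

noncomputable section

namespace BerkLine

/-! ### Balls and open affinoids of the projective line -/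

section Balls

variable (K : Type*) [NormedField K]

/-- The value group `|K^*|`, as a set of positive real numbers. -/
def valueGroup : Set ℝ := {r | ∃ z : K, z ≠ 0 ∧ ‖z‖ = r}

/-- The projective line of `K`: the lines through the origin of `K × K`. -/
def P1 : Type _ := Projectivization K (K × K)

variable {K}

/-- The point `[z : 1]`. -/
def P1.of (z : K) : P1 K :=
  Projectivization.mk K (z, (1 : K)) (fun h => one_ne_zero (congrArg Prod.snd h))

variable (K) in
/-- The point at infinity `[1 : 0]`. -/
def P1.infty : P1 K :=
  Projectivization.mk K ((1 : K), (0 : K)) (fun h => one_ne_zero (congrArg Prod.fst h))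

theorem P1.of_injective : Function.Injective (P1.of : K → P1 K) := by
  intro x y h
  obtain ⟨a, ha⟩ := (Projectivization.mk_eq_mk_iff' K _ _ _ _).1 h
  simp only [Prod.smul_mk, smul_eq_mul, mul_one, Prod.mk.injEq] at ha
  obtain ⟨h1, h2⟩ := ha
  rw [← h1, h2, one_mul]

theorem P1.of_ne_infty (x : K) : P1.of x ≠ P1.infty K := by
  intro h
  obtain ⟨a, ha⟩ := (Projectivization.mk_eq_mk_iff' K _ _ _ _).1 h
  simp at ha

theorem P1.eq_infty_or_of (p : P1 K) : p = P1.infty K ∨ ∃ x : K, p = P1.of x := by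
  induction p using Projectivization.ind with
  | h v hv =>
    obtain ⟨x, y⟩ := v
    by_cases hy : y = 0
    · left
      subst hy
      refine (Projectivization.mk_eq_mk_iff' K _ _ _ _).2 ⟨x, by simp⟩
    · right
      refine ⟨x / y, (Projectivization.mk_eq_mk_iff' K _ _ _ _).2 ⟨y, ?_⟩⟩
      simp only [Prod.smul_mk, smul_eq_mul, mul_one, Prod.mk.injEq, and_true]
      field_simp

/-- Open balls of `K`: the radius belongs to the value group. -/
def IsOpenBallK (B : Set K) : Prop :=
  ∃ a : K, ∃ r ∈ valueGroup K, B = {z | ‖z - a‖ < r}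

/-- Closed balls of `K`: the radius belongs to the value group. -/
def IsClosedBallK (B : Set K) : Prop :=
  ∃ a : K, ∃ r ∈ valueGroup K, B = {z | ‖z - a‖ ≤ r}

/-- Irrational balls of `K`: the radius is positive and not in the value group (so that a
strict or a large inequality define the same set). -/
def IsIrrationalBallK (B : Set K) : Prop :=
  ∃ a : K, ∃ r : ℝ, 0 < r ∧ r ∉ valueGroup K ∧ B = {z | ‖z - a‖ ≤ r}

/-- Balls of `K`, of any of the three kinds. -/
def IsBallK (B : Set K) : Prop := IsOpenBallK B ∨ IsClosedBallK B ∨ IsIrrationalBallK B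

/-- Open balls of the projective line. -/
def IsOpenBall (D : Set (P1 K)) : Prop :=
  (∃ B : Set K, IsOpenBallK B ∧ D = P1.of '' B) ∨
    ∃ B : Set K, IsClosedBallK B ∧ D = (P1.of '' B)ᶜ

/-- Closed balls of the projective line. -/
def IsClosedBall (D : Set (P1 K)) : Prop :=
  (∃ B : Set K, IsClosedBallK B ∧ D = P1.of '' B) ∨
    ∃ B : Set K, IsOpenBallK B ∧ D = (P1.of '' B)ᶜ

/-- Irrational balls of the projective line. -/
def IsIrrationalBall (D : Set (P1 K)) : Prop :=
  (∃ B : Set K, IsIrrationalBallK B ∧ D = P1.of '' B) ∨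
    ∃ B : Set K, IsIrrationalBallK B ∧ D = (P1.of '' B)ᶜ

/-- Open affinoids: finite intersections of open balls (the empty intersection being the
whole projective line). -/
def IsOpenAffinoid (Y : Set (P1 K)) : Prop :=
  ∃ s : Set (Set (P1 K)), s.Finite ∧ (∀ D ∈ s, IsOpenBall D) ∧ Y = ⋂₀ s

/-- Finite coverings of the projective line by open affinoids. -/
def IsAffinoidCover (C : Set (Set (P1 K))) : Prop :=
  C.Finite ∧ (∀ Y ∈ C, IsOpenAffinoid Y) ∧ ⋃₀ C = univ

/-- The set `V(C)`, the union of the `Y × Y` for `Y` in `C`. -/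
def coverRel (C : Set (Set (P1 K))) : Set (P1 K × P1 K) := ⋃ Y ∈ C, Y ×ˢ Y

end Balls

/-! ### The uniform structure of finite coverings by open affinoids -/

/-- The residue field of `K`. -/
abbrev ResField (K : Type*) [NormedField K] [IsUltrametricDist K] : Type _ :=
  IsLocalRing.ResidueField (NormedField.valuation (K := K)).valuationSubring

section Uniform

variable {K : Type*} [NormedField K]

theorem isOpenAffinoid_sInter {s : Set (Set (P1 K))} (hs : s.Finite)
    (h : ∀ Y ∈ s, IsOpenAffinoid Y) : IsOpenAffinoid (⋂₀ s) := by
  classical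
  choose! t ht hb he using h
  refine ⟨⋃ Y ∈ s, t Y, hs.biUnion ht, ?_, ?_⟩
  · intro D hD
    obtain ⟨Y, hY, hD⟩ := mem_iUnion₂.1 hD
    exact hb Y hY D hD
  · ext x
    simp only [mem_sInter, mem_iUnion, exists_prop, forall_exists_index, and_imp]
    constructor
    · intro h D Y hY hD
      have := h Y hY
      rw [he Y hY] at this
      exact this D hD
    · intro h Y hY
      rw [he Y hY]
      exact fun D hD => h D Y hY hD

theorem IsOpenBall.isOpenAffinoid {D : Set (P1 K)} (h : IsOpenBall D) : IsOpenAffinoid D :=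
  ⟨{D}, finite_singleton D, by simpa using h, by simp⟩

theorem of_mem_image {B : Set K} {z : K} : P1.of z ∈ P1.of '' B ↔ z ∈ B :=
  P1.of_injective.mem_set_image

theorem infty_notMem_image {B : Set K} : P1.infty K ∉ P1.of '' B := by
  rintro ⟨x, -, hx⟩
  exact P1.of_ne_infty x hx

variable [IsUltrametricDist K]

theorem norm_sub_le_max' (x y z : K) : ‖x - z‖ ≤ max ‖x - y‖ ‖y - z‖ := by
  have := IsUltrametricDist.norm_add_le_max (x - y) (y - z)
  rwa [sub_add_sub_cancel] at this

/-- Representatives of the residue classes, at mutual distance one. -/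
theorem exists_residue_family :
    ∃ t : ResField K → K, (∀ i, ‖t i‖ ≤ 1) ∧ ∀ i j, i ≠ j → ‖t i - t j‖ = 1 := by
  let A := (NormedField.valuation (K := K)).valuationSubring
  have hsurj : Function.Surjective (IsLocalRing.residue A) := IsLocalRing.residue_surjective
  choose t ht using hsurj
  have hle : ∀ a : A, ‖(a : K)‖ ≤ 1 := by
    intro a
    have := (Valuation.mem_valuationSubring_iff _ _).1 a.2
    simpa [← NNReal.coe_le_coe] using this
  refine ⟨fun i => (t i : K), fun i => hle _, ?_⟩
  intro i j hij
  have hu : IsUnit (t i - t j) := by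
    by_contra hu
    have hm : t i - t j ∈ IsLocalRing.maximalIdeal A := hu
    have := (IsLocalRing.residue_eq_zero_iff _).2 hm
    rw [map_sub, ht, ht, sub_eq_zero] at this
    exact hij this
  obtain ⟨u, hu⟩ := hu
  have h1 : ‖((t i - t j : A) : K)‖ ≤ 1 := hle _
  have h2 : ‖((↑u⁻¹ : A) : K)‖ ≤ 1 := hle _
  have h3 : ((t i - t j : A) : K) * ((↑u⁻¹ : A) : K) = 1 := by
    rw [← hu]
    exact congrArg Subtype.val (u.mul_inv)
  have h4 : ‖((t i - t j : A) : K)‖ * ‖((↑u⁻¹ : A) : K)‖ = 1 := by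
    rw [← norm_mul, h3, norm_one]
  have h5 : ((t i - t j : A) : K) = (t i : K) - (t j : K) := rfl
  rw [h5] at h1 h4
  refine le_antisymm h1 ?_
  nlinarith [norm_nonneg ((t i : K) - (t j : K))]

/-- A finite covering of the projective line by open balls contains two balls that already
cover it. -/
theorem exists_pair_cover [Infinite (ResField K)] {S : Set (Set (P1 K))} (hS : S.Finite)
    (hb : ∀ D ∈ S, IsOpenBall D) (hc : ⋃₀ S = univ) :
    ∃ D ∈ S, ∃ D' ∈ S, D ∪ D' = univ := by
  by_contra hno
  push Not at hno
  have hT : {p : K × ℝ | p.2 ∈ valueGroup K ∧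
      (P1.of '' {z : K | ‖z - p.1‖ ≤ p.2})ᶜ ∈ S}.Nonempty := by
    have : P1.infty K ∈ ⋃₀ S := hc ▸ mem_univ _
    obtain ⟨D, hD, hi⟩ := this
    rcases hb D hD with ⟨B, -, rfl⟩ | ⟨B, ⟨a, r, hr, rfl⟩, rfl⟩
    · exact absurd hi infty_notMem_image
    · exact ⟨(a, r), hr, hD⟩
  let f : Set (P1 K) → ℝ := fun D => sInf {r : ℝ | r ∈ valueGroup K ∧
    ∃ a : K, D = (P1.of '' {z : K | ‖z - a‖ ≤ r})ᶜ}
  -- radii of closed balls are determined by the balls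
  have key : ∀ a a' : K, ∀ r ∈ valueGroup K, ∀ r' ∈ valueGroup K,
      (P1.of '' {z : K | ‖z - a‖ ≤ r})ᶜ = (P1.of '' {z : K | ‖z - a'‖ ≤ r'})ᶜ → r' ≤ r := by
    intro a a' r hr r' hr' h
    have h := P1.of_injective.image_injective (compl_injective h)
    obtain ⟨c, hc0, rfl⟩ := hr'
    have h1 : a' ∈ {z : K | ‖z - a‖ ≤ r} := by rw [h]; simp
    have h2 : a' + c ∈ {z : K | ‖z - a‖ ≤ r} := by rw [h]; simp
    have h3 := norm_sub_le_max' (a' + c) a a'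
    rw [add_sub_cancel_left, norm_sub_rev a a'] at h3
    exact h3.trans (max_le h2 h1)
  have hfin : {p : ℝ | p ∈ valueGroup K ∧ ∃ a : K,
      (P1.of '' {z : K | ‖z - a‖ ≤ p})ᶜ ∈ S}.Finite := by
    refine Set.Finite.subset (hS.image f) ?_
    rintro r ⟨hr, a, ha⟩
    refine ⟨_, ha, ?_⟩
    have : {r' : ℝ | r' ∈ valueGroup K ∧
        ∃ a' : K, (P1.of '' {z : K | ‖z - a‖ ≤ r})ᶜ =
          (P1.of '' {z : K | ‖z - a'‖ ≤ r'})ᶜ} = {r} := by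
      ext r'
      simp only [mem_ofPred_eq, mem_singleton_iff]
      constructor
      · rintro ⟨hr', a', h⟩
        exact le_antisymm (key _ _ _ hr _ hr' h) (key _ _ _ hr' _ hr h.symm)
      · rintro rfl
        exact ⟨hr, a, rfl⟩
    show sInf _ = r
    rw [this, csInf_singleton]
  obtain ⟨⟨a₀, r₀⟩, hr₀, ha₀⟩ := hT
  obtain ⟨r, ⟨hr, a, ha⟩, hmin⟩ := hfin.exists_minimal ⟨r₀, hr₀, a₀, ha₀⟩
  obtain ⟨t, ht1, ht2⟩ := exists_residue_family (K := K)
  obtain ⟨c, hc0, rfl⟩ := hr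
  have hcpos : 0 < ‖c‖ := norm_pos_iff.2 hc0
  have hcov : ∀ i, ∃ D ∈ S, P1.of (a + c * t i) ∈ D := by
    intro i
    have : P1.of (a + c * t i) ∈ ⋃₀ S := hc ▸ mem_univ _
    exact this
  choose D hD hmem using hcov
  have := hS.to_subtype
  obtain ⟨i, j, hij, hDij⟩ := Finite.exists_ne_map_eq_of_infinite (fun i => (⟨D i, hD i⟩ : S))
  have hDij : D i = D j := congrArg Subtype.val hDij
  have hin : ∀ i, ‖(a + c * t i) - a‖ ≤ ‖c‖ := by
    intro i
    rw [add_sub_cancel_left, norm_mul]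
    nlinarith [ht1 i]
  rcases hb _ (hD i) with ⟨B, ⟨b, s, hs, rfl⟩, hB⟩ | ⟨B, ⟨b, s, hs, rfl⟩, hB⟩
  · have hi := hmem i
    have hj := hmem j
    rw [← hDij] at hj
    rw [hB, of_mem_image] at hi hj
    have hi : ‖a + c * t i - b‖ < s := hi
    have hj : ‖a + c * t j - b‖ < s := hj
    have hcs : ‖c‖ < s := by
      have h1 := norm_sub_le_max' (a + c * t i) b (a + c * t j)
      rw [norm_sub_rev b] at h1
      have h2 : a + c * t i - (a + c * t j) = c * (t i - t j) := by ring
      rw [h2, norm_mul, ht2 i j hij, mul_one] at h1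
      exact h1.trans_lt (max_lt hi hj)
    refine hno _ ha _ (hD i) ?_
    rw [hB]
    refine eq_univ_of_forall fun p => ?_
    by_cases hp : p ∈ P1.of '' {z : K | ‖z - a‖ ≤ ‖c‖}
    · right
      obtain ⟨z, hz, rfl⟩ := hp
      rw [of_mem_image]
      have hz : ‖z - a‖ ≤ ‖c‖ := hz
      have h1 := norm_sub_le_max' z a b
      have h2 := norm_sub_le_max' a (a + c * t i) b
      rw [norm_sub_rev a (a + c * t i)] at h2
      exact h1.trans_lt (max_lt (hz.trans_lt hcs)
        (h2.trans_lt (max_lt ((hin i).trans_lt hcs) hi)))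
    · exact Or.inl hp
  · have hi := hmem i
    rw [hB, mem_compl_iff, of_mem_image] at hi
    have hi : ¬ ‖a + c * t i - b‖ ≤ s := hi
    have hDi := hD i
    rw [hB] at hDi
    have hle : ‖c‖ ≤ s := by
      by_contra hlt
      push Not at hlt
      exact absurd (hmin ⟨hs, b, hDi⟩ hlt.le) (not_le.2 hlt)
    refine hno _ ha _ hDi ?_
    refine eq_univ_of_forall fun p => ?_
    by_cases hp : p ∈ P1.of '' {z : K | ‖z - a‖ ≤ ‖c‖}
    · right
      obtain ⟨z, hz, rfl⟩ := hp
      rw [mem_compl_iff, of_mem_image]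
      intro hz'
      have hz : ‖z - a‖ ≤ ‖c‖ := hz
      have hz' : ‖z - b‖ ≤ s := hz'
      have h1 := norm_sub_le_max' (a + c * t i) a b
      have h2 := norm_sub_le_max' a z b
      rw [norm_sub_rev a z] at h2
      exact hi (h1.trans (max_le ((hin i).trans hle)
        (h2.trans (max_le (hz.trans hle) hz'))))
    · exact Or.inl hp

end Uniform

section Uniform2

variable {K : Type*} [DenselyNormedField K] [IsUltrametricDist K]

theorem separate_aux {a b : K} {r s : ℝ} (hr : r ∈ valueGroup K)
    (h : (P1.of '' {z : K | ‖z - a‖ ≤ r})ᶜ ∪ P1.of '' {z : K | ‖z - b‖ < s} = univ) :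
    ∃ E E' : Set (P1 K), IsOpenBall E ∧ IsOpenBall E' ∧
      ((P1.of '' {z : K | ‖z - a‖ ≤ r})ᶜ)ᶜ ⊆ E ∧ (P1.of '' {z : K | ‖z - b‖ < s})ᶜ ⊆ E' ∧
      Disjoint E E' := by
  have hsub : ∀ z : K, ‖z - a‖ ≤ r → ‖z - b‖ < s := by
    intro z hz
    have : P1.of z ∈ (P1.of '' {z : K | ‖z - a‖ ≤ r})ᶜ ∪ P1.of '' {z : K | ‖z - b‖ < s} :=
      h ▸ mem_univ _
    rcases this with h1 | h1
    · exact absurd ((of_mem_image (B := {z : K | ‖z - a‖ ≤ r})).2 hz) h1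
    · exact (of_mem_image (B := {z : K | ‖z - b‖ < s})).1 h1
  obtain ⟨c, hc0, rfl⟩ := hr
  have h1 : ‖a - b‖ < s := hsub a (by simp)
  have h2 : ‖a + c - b‖ < s := hsub (a + c) (by simp)
  have h3 : ‖c‖ < s := by
    have := norm_sub_le_max' (a + c) b a
    rw [add_sub_cancel_left, norm_sub_rev b a] at this
    exact this.trans_lt (max_lt h2 h1)
  obtain ⟨(d : K), hd1, hd2⟩ := DenselyNormedField.lt_norm_lt (α := K) (max ‖c‖ ‖a - b‖) s
    ((norm_nonneg c).trans (le_max_left _ _)) (max_lt h3 h1)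
  have hd0 : d ≠ 0 := by
    rintro rfl
    rw [norm_zero] at hd1
    exact absurd hd1 (not_lt.2 ((norm_nonneg c).trans (le_max_left _ _)))
  refine ⟨P1.of '' {z : K | ‖z - b‖ < ‖d‖}, (P1.of '' {z : K | ‖z - b‖ ≤ ‖d‖})ᶜ,
    Or.inl ⟨_, ⟨b, ‖d‖, ⟨d, hd0, rfl⟩, rfl⟩, rfl⟩,
    Or.inr ⟨_, ⟨b, ‖d‖, ⟨d, hd0, rfl⟩, rfl⟩, rfl⟩, ?_, ?_, ?_⟩
  · rw [compl_compl]
    refine image_mono fun z (hz : ‖z - a‖ ≤ ‖c‖) => ?_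
    exact (norm_sub_le_max' z a b).trans_lt ((max_le_max_right _ hz).trans_lt hd1)
  · exact compl_subset_compl.2 (image_mono fun z (hz : ‖z - b‖ ≤ ‖d‖) => hz.trans_lt hd2)
  · exact disjoint_compl_right_iff_subset.2
      (image_mono fun z (hz : ‖z - b‖ < ‖d‖) => hz.le)

/-- Two open balls that cover the projective line have complements with disjoint
neighbourhoods that are open balls. -/
theorem exists_separate {D D' : Set (P1 K)} (hD : IsOpenBall D) (hD' : IsOpenBall D')
    (h : D ∪ D' = univ) : ∃ E E' : Set (P1 K), IsOpenBall E ∧ IsOpenBall E' ∧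
      Dᶜ ⊆ E ∧ D'ᶜ ⊆ E' ∧ Disjoint E E' := by
  rcases hD with ⟨B, ⟨a, r, hr, rfl⟩, rfl⟩ | ⟨B, ⟨a, r, hr, rfl⟩, rfl⟩ <;>
    rcases hD' with ⟨B', ⟨b, s, hs, rfl⟩, rfl⟩ | ⟨B', ⟨b, s, hs, rfl⟩, rfl⟩
  · exfalso
    have : P1.infty K ∈ P1.of '' {z : K | ‖z - a‖ < r} ∪ P1.of '' {z : K | ‖z - b‖ < s} :=
      h ▸ mem_univ _
    rcases this with h1 | h1 <;> exact infty_notMem_image h1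
  · rw [union_comm] at h
    obtain ⟨E, E', h1, h2, h3, h4, h5⟩ := separate_aux hs h
    exact ⟨E', E, h2, h1, h4, h3, h5.symm⟩
  · exact separate_aux hr h
  · have hdis : ∀ z : K, ‖z - a‖ ≤ r → ¬ ‖z - b‖ ≤ s := by
      intro z hz hz'
      have : P1.of z ∈ (P1.of '' {z : K | ‖z - a‖ ≤ r})ᶜ ∪ (P1.of '' {z : K | ‖z - b‖ ≤ s})ᶜ :=
        h ▸ mem_univ _
      rcases this with h1 | h1
      · exact h1 ((of_mem_image (B := {z : K | ‖z - a‖ ≤ r})).2 hz)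
      · exact h1 ((of_mem_image (B := {z : K | ‖z - b‖ ≤ s})).2 hz')
    have hr0 : 0 ≤ r := by obtain ⟨c, -, rfl⟩ := hr; exact norm_nonneg c
    have hs0 : 0 ≤ s := by obtain ⟨c, -, rfl⟩ := hs; exact norm_nonneg c
    have h1 : s < ‖a - b‖ := not_le.1 (hdis a (by simpa using hr0))
    have h2 : r < ‖a - b‖ := by
      by_contra hle
      push Not at hle
      rw [norm_sub_rev] at hle
      exact hdis b hle (by simpa using hs0)
    have hv : ‖a - b‖ ∈ valueGroup K :=
      ⟨a - b, norm_pos_iff.1 (hr0.trans_lt h2), rfl⟩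
    refine ⟨P1.of '' {z : K | ‖z - a‖ < ‖a - b‖}, P1.of '' {z : K | ‖z - b‖ < ‖a - b‖},
      Or.inl ⟨_, ⟨a, _, hv, rfl⟩, rfl⟩, Or.inl ⟨_, ⟨b, _, hv, rfl⟩, rfl⟩, ?_, ?_, ?_⟩
    · rw [compl_compl]
      exact image_mono fun z (hz : ‖z - a‖ ≤ r) => hz.trans_lt h2
    · rw [compl_compl]
      exact image_mono fun z (hz : ‖z - b‖ ≤ s) => hz.trans_lt h1
    · rw [disjoint_image_iff P1.of_injective, Set.disjoint_left]
      intro z (hz : ‖z - a‖ < ‖a - b‖) (hz' : ‖z - b‖ < ‖a - b‖)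
      have := norm_sub_le_max' a z b
      rw [norm_sub_rev a z] at this
      exact absurd this (not_le.2 (max_lt hz hz'))

/-- Every finite covering by open affinoids has a finite point-star refinement by open
affinoids. -/
theorem exists_star_refinement [Infinite (ResField K)] {C : Set (Set (P1 K))}
    (hC : IsAffinoidCover C) : ∃ C' : Set (Set (P1 K)), IsAffinoidCover C' ∧
      ∀ x : P1 K, ∃ Y ∈ C, ∀ Y' ∈ C', x ∈ Y' → Y' ⊆ Y := by
  classical
  obtain ⟨hfin, haff, hcov⟩ := hC
  choose! s hs hb he using haff
  let S : Set (Set (P1 K)) := ⋃ Y ∈ C, s Y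
  have hS : S.Finite := hfin.biUnion hs
  have hSb : ∀ D ∈ S, IsOpenBall D := by
    intro D hD
    obtain ⟨Y, hY, hD⟩ := mem_iUnion₂.1 hD
    exact hb Y hY D hD
  have hsep : ∀ D D' : Set (P1 K), (D ∈ S ∧ D' ∈ S ∧ D ∪ D' = univ) →
      ∃ E E' : Set (P1 K), IsOpenBall E ∧ IsOpenBall E' ∧
        Dᶜ ⊆ E ∧ D'ᶜ ⊆ E' ∧ Disjoint E E' :=
    fun D D' h => exists_separate (hSb D h.1) (hSb D' h.2.1) h.2.2
  choose! u v hu hv hDu hDv huv using hsep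
  -- an open affinoid neighbourhood of the complement of `D`
  let e : Set (P1 K) → Set (P1 K) := fun D =>
    ⋂₀ ((u D '' {D' | D' ∈ S ∧ D ∪ D' = univ}) ∪
      ((fun D' => v D' D) '' {D' | D' ∈ S ∧ D' ∪ D = univ}))
  have hefin : ∀ D, ((u D '' {D' | D' ∈ S ∧ D ∪ D' = univ}) ∪
      ((fun D' => v D' D) '' {D' | D' ∈ S ∧ D' ∪ D = univ})).Finite := fun D =>
    ((hS.subset fun _ h => h.1).image _).union ((hS.subset fun _ h => h.1).image _)
  have heaff : ∀ D ∈ S, IsOpenAffinoid (e D) := by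
    intro D hD
    refine isOpenAffinoid_sInter (hefin D) ?_
    rintro _ (⟨D', h, rfl⟩ | ⟨D', h, rfl⟩)
    · exact (hu D D' ⟨hD, h⟩).isOpenAffinoid
    · exact (hv D' D ⟨h.1, hD, h.2⟩).isOpenAffinoid
  have heD : ∀ D ∈ S, Dᶜ ⊆ e D := by
    intro D hD
    refine subset_sInter ?_
    rintro _ (⟨D', h, rfl⟩ | ⟨D', h, rfl⟩)
    · exact hDu D D' ⟨hD, h⟩
    · exact hDv D' D ⟨h.1, hD, h.2⟩
  have hdisj : ∀ D ∈ S, ∀ D' ∈ S, D ∪ D' = univ → Disjoint (e D) (e D') := by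
    intro D hD D' hD' h
    refine (huv D D' ⟨hD, hD', h⟩).mono ?_ ?_
    · exact sInter_subset_of_mem (Or.inl ⟨D', ⟨hD', h⟩, rfl⟩)
    · exact sInter_subset_of_mem (Or.inr ⟨D, ⟨hD, h⟩, rfl⟩)
  -- the refinement: intersections over `S` of a choice between `D` and `e D`
  let g : Set (Set (P1 K)) → Set (P1 K) := fun T => ⋂₀ (T ∪ e '' (S \ T))
  refine ⟨g '' {T | T ⊆ S}, ⟨hS.finite_subsets.image g, ?_, ?_⟩, ?_⟩
  · rintro _ ⟨T, hT, rfl⟩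
    refine isOpenAffinoid_sInter ((hS.subset hT).union ((hS.subset sdiff_subset).image e)) ?_
    rintro _ (hD | ⟨D, hD, rfl⟩)
    · exact (hSb _ (hT hD)).isOpenAffinoid
    · exact heaff D hD.1
  · refine eq_univ_of_forall fun x => ?_
    refine ⟨_, ⟨{D | D ∈ S ∧ x ∈ D}, fun D hD => hD.1, rfl⟩, ?_⟩
    rintro _ (hD | ⟨D, hD, rfl⟩)
    · exact hD.2
    · exact heD D hD.1 fun hx => hD.2 ⟨hD.1, hx⟩
  · intro x
    have hx : ∃ Y ∈ C, ∀ D ∈ s Y, x ∉ e D := by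
      by_contra hno
      push Not at hno
      choose! d hd hxd using hno
      have hdS : ∀ Y ∈ C, d Y ∈ S := fun Y hY => mem_iUnion₂.2 ⟨Y, hY, hd Y hY⟩
      obtain ⟨_, ⟨Y, hY, rfl⟩, _, ⟨Y', hY', rfl⟩, h⟩ :=
        exists_pair_cover (S := d '' C) (hfin.image d)
          (by rintro _ ⟨Y, hY, rfl⟩; exact hSb _ (hdS Y hY))
          (by
            refine eq_univ_of_forall fun y => ?_
            have : y ∈ ⋃₀ C := hcov ▸ mem_univ y
            obtain ⟨Y, hY, hy⟩ := this
            rw [he Y hY] at hy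
            exact ⟨d Y, ⟨Y, hY, rfl⟩, hy _ (hd Y hY)⟩)
      exact Set.disjoint_left.1 (hdisj _ (hdS Y hY) _ (hdS Y' hY') h) (hxd Y hY) (hxd Y' hY')
    obtain ⟨Y, hY, hxY⟩ := hx
    refine ⟨Y, hY, ?_⟩
    rintro _ ⟨T, hT, rfl⟩ hxT
    rw [he Y hY]
    refine subset_sInter fun D hD => sInter_subset_of_mem (Or.inl ?_)
    by_contra hDT
    exact hxY D hD (hxT _ (Or.inr ⟨D, ⟨mem_iUnion₂.2 ⟨Y, hY, hD⟩, hDT⟩, rfl⟩))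

/-- The filter on `ℙ¹ × ℙ¹` of all sets that contain some `V(C)`, for `C` a finite covering
by open affinoids. -/
def affinoidUniformity (K : Type*) [NormedField K] : Filter (P1 K × P1 K) where
  sets := {V | ∃ C, IsAffinoidCover C ∧ coverRel C ⊆ V}
  univ_sets := ⟨{univ}, ⟨finite_singleton _, by
    rintro _ rfl
    exact ⟨∅, finite_empty, by simp, by simp⟩, by simp⟩, subset_univ _⟩
  sets_of_superset := by
    rintro V W ⟨C, hC, h⟩ hVW
    exact ⟨C, hC, h.trans hVW⟩
  inter_sets := by
    rintro V W ⟨C, ⟨hC1, hC2, hC3⟩, hV⟩ ⟨C', ⟨hC1', hC2', hC3'⟩, hW⟩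
    refine ⟨image2 (· ∩ ·) C C', ⟨hC1.image2 _ hC1', ?_, ?_⟩, ?_⟩
    · rintro _ ⟨Y, hY, Y', hY', rfl⟩
      have := isOpenAffinoid_sInter (s := {Y, Y'}) (by simp)
        (by rintro _ (rfl | rfl); exacts [hC2 _ hY, hC2' _ hY'])
      simpa using this
    · refine eq_univ_of_forall fun x => ?_
      obtain ⟨Y, hY, hx⟩ : x ∈ ⋃₀ C := hC3 ▸ mem_univ x
      obtain ⟨Y', hY', hx'⟩ : x ∈ ⋃₀ C' := hC3' ▸ mem_univ x
      exact ⟨Y ∩ Y', ⟨Y, hY, Y', hY', rfl⟩, hx, hx'⟩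
    · intro p hp
      obtain ⟨_, ⟨Y, hY, Y', hY', rfl⟩, h1, h2⟩ := mem_iUnion₂.1 hp
      exact ⟨hV (mem_iUnion₂.2 ⟨Y, hY, h1.1, h2.1⟩), hW (mem_iUnion₂.2 ⟨Y', hY', h1.2, h2.2⟩)⟩

/-- The projective line with the uniform structure of finite coverings by open affinoids. -/
instance [Infinite (ResField K)] : UniformSpace (P1 K) :=
  UniformSpace.ofCore <| UniformSpace.Core.mk' (affinoidUniformity K)
    (by
      rintro V ⟨C, hC, hV⟩ x
      obtain ⟨Y, hY, hx⟩ : x ∈ ⋃₀ C := hC.2.2 ▸ mem_univ x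
      exact hV (mem_iUnion₂.2 ⟨Y, hY, hx, hx⟩))
    (by
      rintro V ⟨C, hC, hV⟩
      refine ⟨C, hC, fun p hp => hV ?_⟩
      obtain ⟨Y, hY, h1, h2⟩ := mem_iUnion₂.1 hp
      exact mem_iUnion₂.2 ⟨Y, hY, h2, h1⟩)
    (by
      rintro V ⟨C, hC, hV⟩
      obtain ⟨C', hC', hstar⟩ := exists_star_refinement hC
      refine ⟨coverRel C', ⟨C', hC', Subset.rfl⟩, ?_⟩
      rintro ⟨x, z⟩ ⟨y, hxy, hyz⟩
      obtain ⟨Y, hY, h1, h2⟩ := mem_iUnion₂.1 hxy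
      obtain ⟨Y', hY', h3, h4⟩ := mem_iUnion₂.1 hyz
      obtain ⟨W, hW, hsub⟩ := hstar y
      exact hV (mem_iUnion₂.2 ⟨W, hW, hsub Y hY h2 h1, hsub Y' hY' h3 h4⟩))

theorem mem_uniformity_P1 [Infinite (ResField K)] {V : Set (P1 K × P1 K)} :
    V ∈ 𝓤 (P1 K) ↔ ∃ C, IsAffinoidCover C ∧ coverRel C ⊆ V := Iff.rfl

end Uniform2

/-! ### The compactification: minimal Cauchy filters -/

section Ber

variable (K : Type*) [DenselyNormedField K] [IsUltrametricDist K] [Infinite (ResField K)]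

/-- The compactification: the set of minimal Cauchy filters on the projective line, that is,
the Cauchy filters `F` such that no Cauchy filter is strictly coarser than `F`. It is the
Hausdorff completion of the projective line. -/
def Ber : Type _ :=
  {F : CauchyFilter (P1 K) // ∀ G : Filter (P1 K), Cauchy G → F.1 ≤ G → G = F.1}

/-- The uniform structure on minimal Cauchy filters; an entourage contains, for some entourage
`V` of the projective line, all the pairs `(F, G)` with `V ∈ F ×ˢ G`. -/
instance : UniformSpace (Ber K) := inferInstanceAs (UniformSpace {F : CauchyFilter (P1 K) //
  ∀ G : Filter (P1 K), Cauchy G → F.1 ≤ G → G = F.1})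

variable {K}

/-- The underlying filter of a point. -/
def Ber.filter (F : Ber K) : Filter (P1 K) := F.1.1

/-- A point of the projective line, as the minimal Cauchy filter of its neighbourhoods. -/
def P1.toBer (x : P1 K) : Ber K :=
  ⟨⟨𝓝 x, cauchy_nhds⟩, by
    intro G hG (hle : 𝓝 x ≤ G)
    refine le_antisymm ?_ hle
    intro U hU
    obtain ⟨V, hV, hVU⟩ := UniformSpace.mem_nhds_iff.1 hU
    obtain ⟨A, hA, hAV⟩ := cauchy_iff.1 hG |>.2 V hV
    have hx : x ∈ A := mem_of_mem_nhds (hle hA)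
    exact mem_of_superset hA fun y hy => hVU (hAV (mk_mem_prod hx hy))⟩

/-- For a set `Y` of points of the projective line, the set of the points of the
compactification that contain `Y`. The open balls of the compactification are the sets
`Ber.hat B`, for `B` an open or irrational ball. -/
def Ber.hat (Y : Set (P1 K)) : Set (Ber K) := {F | Y ∈ F.filter}

/-- For a set `Y` of points of the projective line, the topological closure of `Y` in the
compactification. The closed balls of the compactification are the sets `Ber.cl B`, for `B` a
closed or irrational ball. -/
def Ber.cl (Y : Set (P1 K)) : Set (Ber K) := closure (P1.toBer '' Y)

/-- The intersection `B_F` of all the balls of `K` that belong to the filter `F`. -/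
def Ber.ball (F : Ber K) : Set K := ⋂₀ {B : Set K | IsBallK B ∧ P1.of '' B ∈ F.filter}

end Ber

/-! ### The tree of balls of `K` -/

section KTree

variable (K : Type*) [NormedField K] [IsUltrametricDist K]

/-- The equivalence relation on `K × [0, ∞)`: `(x, r) ∼ (x', r')` if and only if `r = r'` and
`|x - x'| ≤ r`. -/
def ballSetoid : Setoid (K × ℝ≥0) where
  r p q := p.2 = q.2 ∧ dist p.1 q.1 ≤ p.2
  iseqv :=
    { refl := fun p => ⟨rfl, by simp⟩
      symm := fun {p q} h => ⟨h.1.symm, by rw [dist_comm, ← h.1]; exact h.2⟩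
      trans := fun {p q s} h h' => ⟨h.1.trans h'.1,
        (dist_triangle_max p.1 q.1 s.1).trans (max_le h.2 (by rw [h.1]; exact h'.2))⟩ }

/-- The space of balls, the quotient of `K × [0, ∞)`. -/
def BallTree : Type _ := Quotient (ballSetoid K)

variable {K}

namespace BallTree

/-- The point `[x, r]`. -/
def mk (x : K) (r : ℝ≥0) : BallTree K := Quotient.mk (ballSetoid K) (x, r)

/-- The points of `K`, as `[x, 0]`. -/
def ofPoint (x : K) : BallTree K := mk x 0

/-- The set `B_S`; for `S = [x, r]` it is the set of all `w` with `|w - x| ≤ r`. -/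
def ball : BallTree K → Set K :=
  Quotient.lift (fun p : K × ℝ≥0 => {w : K | dist w p.1 ≤ p.2}) (by
    rintro ⟨x, r⟩ ⟨y, s⟩ ⟨h1, h2⟩
    obtain rfl : r = s := h1
    have h2 : dist x y ≤ r := h2
    ext w
    simp only [mem_ofPred_eq]
    constructor
    · exact fun h => (dist_triangle_max w x y).trans (max_le h h2)
    · exact fun h => (dist_triangle_max w y x).trans (max_le h (by rwa [dist_comm])))

/-- `diam [x, r] = r`. -/
def diam : BallTree K → ℝ :=
  Quotient.lift (fun p : K × ℝ≥0 => (p.2 : ℝ)) (by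
    rintro ⟨x, r⟩ ⟨y, s⟩ ⟨h1, -⟩
    exact congrArg _ h1)

theorem sup_aux {x x' y y' : K} {r s : ℝ≥0} (h : dist x x' ≤ r) (h' : dist y y' ≤ s) :
    max (max (r : ℝ) s) (dist x y) ≤ max (max (r : ℝ) s) (dist x' y') := by
  refine max_le (le_max_left _ _) ?_
  refine (dist_triangle_max x x' y).trans (max_le ?_ ((dist_triangle_max x' y' y).trans
    (max_le (le_max_right _ _) ?_)))
  · exact h.trans ((le_max_left _ _).trans (le_max_left _ _))
  · rw [dist_comm]
    exact h'.trans ((le_max_right _ _).trans (le_max_left _ _))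

/-- `sup {[x, r], [x', r']} = max {r, r', |x - x'|}`. -/
def sup : BallTree K → BallTree K → ℝ :=
  Quotient.lift₂ (fun p q : K × ℝ≥0 => max (max (p.2 : ℝ) q.2) (dist p.1 q.1)) (by
    rintro ⟨x, r⟩ ⟨y, s⟩ ⟨x', r'⟩ ⟨y', s'⟩ ⟨h1, h2⟩ ⟨h3, h4⟩
    obtain rfl : r = r' := h1
    obtain rfl : s = s' := h3
    refine le_antisymm (sup_aux h2 h4) (sup_aux ?_ ?_)
    · rw [dist_comm]; exact h2
    · rw [dist_comm]; exact h4)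

/-- `|[x, r]| = max {|x|, r}`. -/
def abs : BallTree K → ℝ :=
  Quotient.lift (fun p : K × ℝ≥0 => max ‖p.1‖ (p.2 : ℝ)) (by
    rintro ⟨x, r⟩ ⟨y, s⟩ ⟨h1, h2⟩
    obtain rfl : r = s := h1
    have h2 : dist x y ≤ r := h2
    have hxy := dist_triangle_max x y 0
    have hyx := dist_triangle_max y x 0
    rw [dist_zero_right, dist_zero_right] at hxy hyx
    rw [dist_comm y x] at hyx
    refine le_antisymm (max_le ?_ (le_max_right _ _)) (max_le ?_ (le_max_right _ _))
    · exact hxy.trans (max_le (h2.trans (le_max_right _ _)) (le_max_left _ _))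
    · exact hyx.trans (max_le (h2.trans (le_max_right _ _)) (le_max_left _ _)))

theorem sup_self (S : BallTree K) : sup S S = diam S := by
  induction S using Quotient.ind with
  | _ p => simp [sup, diam]

theorem sup_comm (S T : BallTree K) : sup S T = sup T S := by
  induction S using Quotient.ind with
  | _ p =>
    induction T using Quotient.ind with
    | _ q => simp only [sup, Quotient.lift_mk]; rw [max_comm (p.2 : ℝ), dist_comm]

theorem sup_ultra (S T U : BallTree K) : sup S U ≤ max (sup S T) (sup T U) := by
  induction S using Quotient.ind with
  | _ p =>
    induction T using Quotient.ind with
    | _ q =>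
      induction U using Quotient.ind with
      | _ s =>
        simp only [sup, Quotient.lift_mk]
        refine max_le (max_le ?_ ?_) ((dist_triangle_max _ q.1 _).trans ?_)
        · exact le_max_of_le_left (le_max_of_le_left (le_max_left _ _))
        · exact le_max_of_le_right (le_max_of_le_left (le_max_right _ _))
        · exact max_le_max (le_max_right _ _) (le_max_right _ _)

theorem diam_nonneg (S : BallTree K) : 0 ≤ diam S := by
  induction S using Quotient.ind with
  | _ p => exact p.2.2

theorem abs_eq_sup (S : BallTree K) : abs S = sup S (ofPoint 0) := by
  induction S using Quotient.ind with
  | _ p => simp [abs, sup, ofPoint, mk, max_comm]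

theorem eq_of_sup_eq {S T : BallTree K} (h : sup S T = diam S) (h' : sup S T = diam T) :
    S = T := by
  induction S using Quotient.ind with
  | _ p =>
    induction T using Quotient.ind with
    | _ q =>
      simp only [sup, diam, Quotient.lift_mk] at h h'
      exact Quotient.sound ⟨NNReal.coe_injective (h.symm.trans h'), h ▸ le_max_right _ _⟩

theorem diam_le_sup (S T : BallTree K) : diam S ≤ sup S T := by
  have := sup_ultra S T S
  rwa [sup_comm T S, max_self, sup_self] at this

/-- The distance `δ(S, S') = sup {S, S'} - (diam S + diam S') / 2`. -/
instance : MetricSpace (BallTree K) where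
  dist S T := sup S T - (diam S + diam T) / 2
  dist_self S := by
    show sup S S - (diam S + diam S) / 2 = 0
    rw [sup_self]; ring
  dist_comm S T := by
    show sup S T - (diam S + diam T) / 2 = sup T S - (diam T + diam S) / 2
    rw [sup_comm]; ring
  dist_triangle S T U := by
    show sup S U - (diam S + diam U) / 2 ≤
      (sup S T - (diam S + diam T) / 2) + (sup T U - (diam T + diam U) / 2)
    have h1 := diam_le_sup T U
    have h2 := diam_le_sup T S
    rw [sup_comm] at h2
    rcases le_max_iff.1 (sup_ultra S T U) with h | h <;> linarith
  eq_of_dist_eq_zero {S T} h := by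
    have h : sup S T - (diam S + diam T) / 2 = 0 := h
    have h1 := diam_le_sup S T
    have h2 := diam_le_sup T S
    rw [sup_comm] at h2
    exact eq_of_sup_eq (by linarith) (by linarith)

theorem dist_def (S T : BallTree K) : dist S T = sup S T - (diam S + diam T) / 2 := rfl

theorem abs_diam_sub_le (S T : BallTree K) : |diam S - diam T| ≤ 2 * dist S T := by
  have h1 := diam_le_sup S T
  have h2 := diam_le_sup T S
  rw [sup_comm] at h2
  rw [dist_def, abs_le]
  constructor <;> linarith

theorem uniformContinuous_diam : UniformContinuous (diam : BallTree K → ℝ) :=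
  (LipschitzWith.of_dist_le_mul (K := 2) fun S T => by
    rw [Real.dist_eq]; exact abs_diam_sub_le S T).uniformContinuous

theorem uniformContinuous_sup : UniformContinuous₂ (sup : BallTree K → BallTree K → ℝ) := by
  have h : (fun p : BallTree K × BallTree K => sup p.1 p.2) =
      fun p => dist p.1 p.2 + (diam p.1 + diam p.2) * (1 / 2) := by
    funext p; rw [dist_def]; ring
  show UniformContinuous (fun p : BallTree K × BallTree K => sup p.1 p.2)
  rw [h]
  have h1 := uniformContinuous_diam.comp (uniformContinuous_fst (α := BallTree K) (β := BallTree K))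
  have h2 := uniformContinuous_diam.comp (uniformContinuous_snd (α := BallTree K) (β := BallTree K))
  exact (uniformContinuous_fst.dist uniformContinuous_snd).add
    ((h1.add h2).mul_const' (1 / 2))

theorem uniformContinuous_abs : UniformContinuous (abs : BallTree K → ℝ) := by
  have : (abs : BallTree K → ℝ) = fun S => sup S (ofPoint 0) := funext abs_eq_sup
  rw [this]
  have h : UniformContinuous fun p : BallTree K × BallTree K => sup p.1 p.2 :=
    uniformContinuous_sup
  exact h.comp (uniformContinuous_id.prodMk uniformContinuous_const)

end BallTree

variable (K) in
/-- The tree of `K`: the completion of the space of balls for the distance `δ`. -/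
abbrev KTree : Type _ := UniformSpace.Completion (BallTree K)

namespace KTree

/-- The points of `K` in the tree. -/
def ofPoint (x : K) : KTree K := ((BallTree.ofPoint x : BallTree K) : KTree K)

/-- The continuous extension of `diam`. -/
def diam : KTree K → ℝ := UniformSpace.Completion.extension BallTree.diam

/-- The continuous extension of `|·|`. -/
def abs : KTree K → ℝ := UniformSpace.Completion.extension BallTree.abs

/-- The continuous extension of `sup {·, ·}`. -/
def sup : KTree K → KTree K → ℝ := UniformSpace.Completion.extension₂ BallTree.sup

theorem diam_coe (S : BallTree K) : diam (S : KTree K) = S.diam :=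
  UniformSpace.Completion.extension_coe BallTree.uniformContinuous_diam S

theorem abs_coe (S : BallTree K) : abs (S : KTree K) = S.abs :=
  UniformSpace.Completion.extension_coe BallTree.uniformContinuous_abs S

theorem sup_coe (S T : BallTree K) : sup (S : KTree K) (T : KTree K) = S.sup T :=
  UniformSpace.Completion.extension₂_coe_coe BallTree.uniformContinuous_sup S T

theorem continuous_diam : Continuous (diam : KTree K → ℝ) :=
  UniformSpace.Completion.continuous_extension

theorem continuous_abs : Continuous (abs : KTree K → ℝ) :=
  UniformSpace.Completion.continuous_extension

theorem continuous_sup : Continuous fun p : KTree K × KTree K => sup p.1 p.2 :=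
  (UniformSpace.Completion.uniformContinuous_extension₂ (BallTree.sup (K := K))).continuous

theorem sup_self (S : KTree K) : sup S S = diam S := by
  induction S using UniformSpace.Completion.induction_on with
  | hp =>
    exact isClosed_eq (continuous_sup.comp (continuous_id.prodMk continuous_id)) continuous_diam
  | ih S => rw [sup_coe, diam_coe, BallTree.sup_self]

theorem sup_comm (S T : KTree K) : sup S T = sup T S := by
  induction S, T using UniformSpace.Completion.induction_on₂ with
  | hp => exact isClosed_eq continuous_sup (continuous_sup.comp continuous_swap)
  | ih S T => rw [sup_coe, sup_coe, BallTree.sup_comm]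

theorem sup_ultra (S T U : KTree K) : sup S U ≤ max (sup S T) (sup T U) := by
  induction S, T, U using UniformSpace.Completion.induction_on₃ with
  | hp =>
    have h1 : Continuous fun p : KTree K × KTree K × KTree K => sup p.1 p.2.2 :=
      continuous_sup.comp (continuous_fst.prodMk (continuous_snd.comp continuous_snd))
    have h2 : Continuous fun p : KTree K × KTree K × KTree K => sup p.1 p.2.1 :=
      continuous_sup.comp (continuous_fst.prodMk (continuous_fst.comp continuous_snd))
    have h3 : Continuous fun p : KTree K × KTree K × KTree K => sup p.2.1 p.2.2 :=
      continuous_sup.comp continuous_snd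
    exact isClosed_le h1 (h2.max h3)
  | ih S T U => simpa only [sup_coe] using BallTree.sup_ultra S T U

theorem diam_nonneg (S : KTree K) : 0 ≤ diam S := by
  induction S using UniformSpace.Completion.induction_on with
  | hp => exact isClosed_le continuous_const continuous_diam
  | ih S => rw [diam_coe]; exact S.diam_nonneg

theorem abs_eq_sup (S : KTree K) : abs S = sup S (ofPoint 0) := by
  induction S using UniformSpace.Completion.induction_on with
  | hp =>
    exact isClosed_eq continuous_abs
      (continuous_sup.comp (continuous_id.prodMk continuous_const))
  | ih S => rw [abs_coe, ofPoint, sup_coe, BallTree.abs_eq_sup]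

theorem dist_eq (S T : KTree K) : dist S T = sup S T - (diam S + diam T) / 2 := by
  induction S, T using UniformSpace.Completion.induction_on₂ with
  | hp =>
    exact isClosed_eq continuous_dist (continuous_sup.sub
      (((continuous_diam.comp continuous_fst).add
        (continuous_diam.comp continuous_snd)).div_const 2))
  | ih S T => rw [UniformSpace.Completion.dist_eq, sup_coe, diam_coe, diam_coe]; rfl

theorem diam_le_sup (S T : KTree K) : diam S ≤ sup S T := by
  have := sup_ultra S T S
  rwa [sup_comm T S, max_self, sup_self] at this

theorem diam_le_abs (S : KTree K) : diam S ≤ abs S := by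
  rw [abs_eq_sup]; exact diam_le_sup _ _

/-- Open balls of the tree. -/
def IsOpenBall (D : Set (KTree K)) : Prop :=
  ∃ x : K, ∃ r : ℝ, 0 < r ∧ D = {S | sup (ofPoint x) S < r}

/-- Closed balls of the tree. -/
def IsClosedBall (D : Set (KTree K)) : Prop :=
  ∃ x : K, ∃ r : ℝ, 0 < r ∧ D = {S | sup (ofPoint x) S ≤ r}

end KTree

variable (K) in
/-- The projective tree: the tree of `K` together with a point at infinity. -/
inductive ProjTree : Type _
  | of (S : KTree K) : ProjTree
  | infty : ProjTree

namespace ProjTree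

/-- `h(S) = max {1, |S|}`. -/
def height (S : KTree K) : ℝ := max 1 (KTree.abs S)

/-- The chordal distance `Δ`. On the tree of `K` it is
`sup {S, T} / (h(S) h(T)) - diam S / (2 h(S)²) - diam T / (2 h(T)²)`, with `h = max {1, |·|}`;
the value `Δ(S, ∞)` is the limit of `Δ(S, T)` as `|T|` tends to infinity. -/
def chordal : ProjTree K → ProjTree K → ℝ
  | of S, of T => KTree.sup S T / (height S * height T)
      - KTree.diam S / (2 * height S ^ 2) - KTree.diam T / (2 * height T ^ 2)
  | of S, infty => 1 / height S - KTree.diam S / (2 * height S ^ 2)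
  | infty, of T => 1 / height T - KTree.diam T / (2 * height T ^ 2)
  | infty, infty => 0

/-- An auxiliary ultrametric function. -/
def csup : ProjTree K → ProjTree K → ℝ
  | of S, of T => KTree.sup S T / (height S * height T)
  | of S, infty => 1 / height S
  | infty, of T => 1 / height T
  | infty, infty => 0

theorem one_le_height (S : KTree K) : 1 ≤ height S := le_max_left _ _

theorem height_pos (S : KTree K) : 0 < height S := one_pos.trans_le (one_le_height S)

theorem chordal_eq (P Q : ProjTree K) :
    chordal P Q = csup P Q - (csup P P + csup Q Q) / 2 := by
  have h : ∀ S : KTree K, height S ≠ 0 := fun S => (height_pos S).ne'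
  rcases P with S | _ <;> rcases Q with T | _ <;> simp only [chordal, csup, KTree.sup_self]
  · have hS := h S
    have hT := h T
    field_simp
    ring
  · have hS := h S
    field_simp
    ring
  · have hT := h T
    field_simp
    ring
  · ring

theorem csup_comm (P Q : ProjTree K) : csup P Q = csup Q P := by
  cases P <;> cases Q <;> simp only [csup]
  rw [KTree.sup_comm, mul_comm]

theorem height_le (S T : KTree K) : height S ≤ max (KTree.sup S T) (height T) := by
  refine max_le (le_max_of_le_right (one_le_height T)) ?_
  rw [KTree.abs_eq_sup]
  refine (KTree.sup_ultra S T _).trans (max_le_max_left _ ?_)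
  rw [← KTree.abs_eq_sup]
  exact le_max_right _ _

theorem sup_le_height (S T : KTree K) : KTree.sup S T ≤ max (height S) (height T) := by
  refine (KTree.sup_ultra S (KTree.ofPoint 0) T).trans ?_
  rw [KTree.sup_comm (KTree.ofPoint 0), ← KTree.abs_eq_sup, ← KTree.abs_eq_sup]
  exact max_le_max (le_max_right _ _) (le_max_right _ _)

theorem sup_nonneg (S T : KTree K) : 0 ≤ KTree.sup S T :=
  (KTree.diam_nonneg S).trans (KTree.diam_le_sup S T)

theorem ptolemy (S T U : KTree K) : height T * KTree.sup S U ≤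
    max (height U * KTree.sup S T) (height S * KTree.sup T U) := by
  wlog h : height S ≤ height U generalizing S U
  · have := this U S (le_of_not_ge h)
    rwa [KTree.sup_comm U S, KTree.sup_comm U T, KTree.sup_comm T S, max_comm] at this
  have hST := sup_nonneg S T
  have hTU := sup_nonneg T U
  have hSU := sup_nonneg S U
  have pS := height_pos S
  have pT := height_pos T
  have pU := height_pos U
  rcases le_or_gt (height T) (height S) with h1 | h1
  · rcases le_max_iff.1 (KTree.sup_ultra S T U) with h2 | h2
    · exact le_max_of_le_left (mul_le_mul (h1.trans h) h2 hSU pU.le)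
    · exact le_max_of_le_right (mul_le_mul h1 h2 hSU pS.le)
  · have h2 : height T ≤ KTree.sup S T := by
      have := height_le T S
      rw [KTree.sup_comm] at this
      exact (le_max_iff.1 this).resolve_right (not_le.2 h1)
    have h3 := sup_le_height S U
    rw [max_eq_right h] at h3
    refine le_max_of_le_left ?_
    rw [mul_comm (height U)]
    exact mul_le_mul h2 h3 hSU (pT.le.trans h2)

theorem csup_ultra (P Q R : ProjTree K) : csup P R ≤ max (csup P Q) (csup Q R) := by
  rcases P with S | _ <;> rcases Q with T | _ <;> rcases R with U | _ <;> simp only [csup]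
  · have pS := height_pos S
    have pT := height_pos T
    have pU := height_pos U
    rcases le_max_iff.1 (ptolemy S T U) with h | h
    · refine le_max_of_le_left ?_
      rw [div_le_div_iff₀ (by positivity) (by positivity)]
      nlinarith
    · refine le_max_of_le_right ?_
      rw [div_le_div_iff₀ (by positivity) (by positivity)]
      nlinarith
  · have pS := height_pos S
    have pT := height_pos T
    rcases le_max_iff.1 (height_le T S) with h | h
    · refine le_max_of_le_left ?_
      rw [KTree.sup_comm] at h
      rw [div_le_div_iff₀ (by positivity) (by positivity)]
      nlinarith
    · exact le_max_of_le_right (one_div_le_one_div_of_le pT h)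
  · have pS := height_pos S
    have pU := height_pos U
    rcases le_max_iff.1 (sup_le_height S U) with h | h
    · refine le_max_of_le_right ?_
      rw [div_le_div_iff₀ (by positivity) (by positivity)]
      nlinarith
    · refine le_max_of_le_left ?_
      rw [div_le_div_iff₀ (by positivity) (by positivity)]
      nlinarith
  · exact le_max_left _ _
  · have pT := height_pos T
    have pU := height_pos U
    rcases le_max_iff.1 (height_le T U) with h | h
    · refine le_max_of_le_right ?_
      rw [div_le_div_iff₀ (by positivity) (by positivity)]
      nlinarith
    · exact le_max_of_le_left (one_div_le_one_div_of_le pT h)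
  · have := height_pos T
    exact le_max_of_le_left (by positivity)
  · exact le_max_right _ _
  · exact le_max_left _ _

theorem csup_self_le (P Q : ProjTree K) : csup P P ≤ csup P Q := by
  have := csup_ultra P Q P
  rwa [csup_comm Q P, max_self] at this

theorem eq_of_csup_eq {P Q : ProjTree K} (h : csup P Q = csup P P) (h' : csup P Q = csup Q Q) :
    P = Q := by
  rcases P with S | _ <;> rcases Q with T | _ <;> simp only [csup] at h h'
  · have pS := height_pos S
    have pT := height_pos T
    have key : ∀ S T : KTree K, KTree.sup S T / (height S * height T) =
        KTree.sup T T / (height T * height T) → height T ≤ height S := by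
      intro S T h
      by_contra hlt
      push Not at hlt
      have pS := height_pos S
      have pT := height_pos T
      have h1 : height T ≤ KTree.sup S T := by
        have := height_le T S
        rw [KTree.sup_comm] at this
        exact (le_max_iff.1 this).resolve_right (not_le.2 hlt)
      have h2 : KTree.sup T T ≤ height T := by
        simpa using sup_le_height T T
      rw [div_eq_div_iff (by positivity) (by positivity)] at h
      have h3 : KTree.sup T T * (height S * height T) ≤ height T * (height S * height T) :=
        mul_le_mul_of_nonneg_right h2 (by positivity)
      have h4 : height T * (height T * height T) ≤ KTree.sup S T * (height T * height T) :=
        mul_le_mul_of_nonneg_right h1 (by positivity)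
      have h5 : height S * (height T * height T) < height T * (height T * height T) :=
        mul_lt_mul_of_pos_right hlt (by positivity)
      nlinarith
    have hT : height T ≤ height S := key S T h'
    have hS : height S ≤ height T := by
      apply key T S
      rw [KTree.sup_comm, mul_comm]
      exact h
    have he : height S = height T := le_antisymm hS hT
    rw [he] at h h'
    have h1 : KTree.sup S T = KTree.sup S S := by
      field_simp at h; exact h
    have h2 : KTree.sup S T = KTree.sup T T := by
      field_simp at h'; exact h'
    rw [KTree.sup_self] at h1 h2
    congr 1
    refine dist_eq_zero.1 ?_
    rw [KTree.dist_eq]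
    linarith
  · have := height_pos S
    have : 0 < 1 / height S := by positivity
    linarith
  · have := height_pos T
    have : 0 < 1 / height T := by positivity
    linarith
  · rfl

instance : MetricSpace (ProjTree K) where
  dist := chordal
  dist_self P := by
    show chordal P P = 0
    rw [chordal_eq]; ring
  dist_comm P Q := by
    show chordal P Q = chordal Q P
    rw [chordal_eq, chordal_eq, csup_comm]; ring
  dist_triangle P Q R := by
    show chordal P R ≤ chordal P Q + chordal Q R
    rw [chordal_eq, chordal_eq, chordal_eq]
    have h1 := csup_self_le Q R
    have h2 := csup_self_le Q P
    rw [csup_comm] at h2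
    rw [csup_comm Q P] at h2
    rcases le_max_iff.1 (csup_ultra P Q R) with h | h <;> linarith
  eq_of_dist_eq_zero {P Q} h := by
    have h : chordal P Q = 0 := h
    rw [chordal_eq] at h
    have h1 := csup_self_le P Q
    have h2 := csup_self_le Q P
    rw [csup_comm Q P] at h2
    exact eq_of_csup_eq (by linarith) (by linarith)

/-- The points of the space of balls, as points of the projective tree. -/
def ofBall (S : BallTree K) : ProjTree K := of (S : KTree K)

/-- The points of the projective line that belong to a set `D` of points of the projective
tree; the projective line is identified with `K` together with the point at infinity. -/
def trace (D : Set (ProjTree K)) : Set (P1 K) :=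
  {p | (∃ x : K, p = P1.of x ∧ of (KTree.ofPoint x) ∈ D) ∨ (p = P1.infty K ∧ infty ∈ D)}

/-- Open balls of the projective tree. -/
def IsOpenBall (D : Set (ProjTree K)) : Prop :=
  (∃ E : Set (KTree K), KTree.IsOpenBall E ∧ D = of '' E) ∨
    ∃ E : Set (KTree K), KTree.IsClosedBall E ∧ D = (of '' E)ᶜ

/-- Closed balls of the projective tree. -/
def IsClosedBall (D : Set (ProjTree K)) : Prop :=
  (∃ E : Set (KTree K), KTree.IsClosedBall E ∧ D = of '' E) ∨
    ∃ E : Set (KTree K), KTree.IsOpenBall E ∧ D = (of '' E)ᶜ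

end ProjTree

end KTree

end BerkLine

end

open BerkLine

noncomputable section

namespace BerkLine

/-! ### Radii -/

section Radii

variable {K : Type*} [DenselyNormedField K]

/-! A point `P` of the projective tree is governed by the open balls that contain it, so `ι` sends
`P` to `P.filter`, the filter on the projective line generated by the traces of these balls.
Everything reduces to two kinds of statements.

The tree can be read off from the filters. A point `S` of the tree is determined by the function `x
↦ sup {x, S}` on `K`. Because the value group is dense, there are points `z` of `K` with `sup {z,
S}` tending to `diam S` from above, and, if `B_S` has a center and positive diameter, points tending
to its boundary from inside. Testing on them shows that the trace of an open ball `D` belongs to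
`P.filter` exactly when `P ∈ D` (`trace_mem_filter_iff`). Hence `ι` is injective, and open balls are
determined by their traces, which are the strict balls of arbitrary positive radius and the
complements of the large ones; these are exactly the open or irrational balls of the projective
line. Closed balls follow by complementation.

The uniformity can be tested on pairs of balls. The residue field being infinite, a finite covering
by open balls contains two balls that already cover (`exists_pair_cover`). So a filter meets the
requirement of a covering by affinoids once it chooses a member in finitely many coverings by two
open balls (`IsAffinoidCover.exists_pairs`), and a Cauchy filter always makes such choices
(`Cauchy.mem_or_mem`). Each such pair has a Lebesgue number for the chordal distance
(`exists_pos_forall_mem_sup`), which gives at once that `P.filter` is Cauchy and that `ι` is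
uniformly continuous. Minimality comes from the room left by strict inequalities between radii. For
surjectivity, a Cauchy filter either contains no ball of `K`, and then it refines the filter of
infinity, or the balls in it with radii tending to the infimum form a Cauchy sequence in the tree,
whose limit is the point sought (`exists_le_of_filter`). -/

theorem exists_valueGroup_between {r s : ℝ} (hrs : r < s) (hs : 0 < s) :
    ∃ t ∈ valueGroup K, r < t ∧ t < s := by
  obtain ⟨z, hz1, hz2⟩ := NormedField.exists_lt_norm_lt K (le_max_right r 0) (max_lt hrs hs)
  exact ⟨‖z‖, ⟨z, norm_pos_iff.1 ((le_max_right _ _).trans_lt hz1), rfl⟩,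
    (le_max_left _ _).trans_lt hz1, hz2⟩

theorem valueGroup_pos {r : ℝ} (hr : r ∈ valueGroup K) : 0 < r := by
  obtain ⟨z, hz, rfl⟩ := hr
  exact norm_pos_iff.2 hz

theorem norm_le_iff_lt_of_notMem {r : ℝ} (hr : 0 < r) (hv : r ∉ valueGroup K) (z : K) :
    ‖z‖ ≤ r ↔ ‖z‖ < r := by
  refine ⟨fun h => lt_of_le_of_ne h fun he => hv ⟨z, ?_, he⟩, le_of_lt⟩
  rintro rfl
  rw [norm_zero] at he
  exact hr.ne he

theorem exists_norm_eq_of_mem (a : K) {t : ℝ} (ht : t ∈ valueGroup K) : ∃ z : K, ‖z - a‖ = t := by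
  obtain ⟨c, -, rfl⟩ := ht
  exact ⟨a + c, by rw [add_sub_cancel_left]⟩

/-- The filter on `K` of the approximations from below of a ball with center `x`. -/
def below (x : K) (d : ℝ) : Filter K := comap (fun z => ‖z - x‖) (𝓝[<] d)

theorem below_neBot (x : K) {d : ℝ} (hd : 0 < d) : (below x d).NeBot := by
  rw [below, comap_neBot_iff]
  intro U hU
  obtain ⟨r, hr : r < d, hU⟩ := mem_nhdsLT_iff_exists_Ioo_subset.1 hU
  obtain ⟨t, ht, h1, h2⟩ := exists_valueGroup_between (K := K) hr hd
  obtain ⟨z, hz⟩ := exists_norm_eq_of_mem x ht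
  exact ⟨z, hU ⟨hz ▸ h1, hz ▸ h2⟩⟩

theorem eventually_below_lt (x : K) (d : ℝ) : ∀ᶠ z in below x d, ‖z - x‖ < d :=
  preimage_mem_comap self_mem_nhdsWithin

end Radii

/-! ### Points of the tree seen from `K`, and their approximations by points of `K` -/

namespace KTree

section

variable {K : Type*} [NormedField K] [IsUltrametricDist K]

theorem sup_ofPoint_coe (x a : K) (r : ℝ≥0) :
    sup (ofPoint x) (BallTree.mk a r : KTree K) = max (r : ℝ) ‖x - a‖ := by
  rw [ofPoint, sup_coe, ← dist_eq_norm]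
  show max (max ((0 : ℝ≥0) : ℝ) r) (dist x a) = _
  rw [NNReal.coe_zero, max_eq_right (NNReal.coe_nonneg r)]

theorem sup_ofPoint (x y : K) : sup (ofPoint x) (ofPoint y) = ‖x - y‖ := by
  have h := sup_ofPoint_coe x y 0
  rwa [NNReal.coe_zero, max_eq_right (norm_nonneg _)] at h

theorem diam_mk (a : K) (r : ℝ≥0) : diam (BallTree.mk a r : KTree K) = r := diam_coe _

theorem diam_le_sup' (S T : KTree K) : diam T ≤ sup S T := by
  rw [sup_comm]; exact diam_le_sup T S

theorem sup_ofPoint_ultra (x y : K) (S : KTree K) :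
    sup (ofPoint x) S ≤ max ‖x - y‖ (sup (ofPoint y) S) := by
  rw [← sup_ofPoint]; exact sup_ultra _ _ _

theorem norm_sub_le_sup (x y : K) (S : KTree K) :
    ‖x - y‖ ≤ max (sup (ofPoint x) S) (sup (ofPoint y) S) := by
  rw [← sup_ofPoint, sup_comm (ofPoint y)]; exact sup_ultra _ _ _

theorem eq_of_sup_le {S T : KTree K} (h : sup S T ≤ diam S) (h' : sup S T ≤ diam T) :
    S = T := by
  refine dist_le_zero.1 ?_
  rw [dist_eq]
  linarith

/-- Points of `K` are at distance close to the least possible from a point of the tree. -/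
theorem exists_sup_ofPoint_lt (S : KTree K) {r : ℝ} (hr : diam S < r) :
    ∃ a : K, sup (ofPoint a) S < r := by
  -- For `T = [a, t]`, the inequality `t ≤ sup {S, T}` gives `sup {S, T} ≤ diam S + 2 δ(S, T)`,
  -- whence the half.
  obtain ⟨T, hT⟩ : ∃ T : BallTree K, dist S (T : KTree K) < (r - diam S) / 2 := by
    obtain ⟨_, h, T, rfl⟩ := Metric.dense_iff.1
      (UniformSpace.Completion.denseRange_coe (α := BallTree K)) S _ (half_pos (sub_pos.2 hr))
    exact ⟨T, by rw [dist_comm]; exact h⟩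
  induction T using Quotient.ind with
  | _ p =>
    obtain ⟨a, t⟩ := p
    change dist S (BallTree.mk a t : KTree K) < _ at hT
    refine ⟨a, ?_⟩
    have h1 := sup_ultra (ofPoint a) (BallTree.mk a t : KTree K) S
    rw [sup_ofPoint_coe, sub_self, norm_zero, max_eq_left (NNReal.coe_nonneg t),
      sup_comm (BallTree.mk a t : KTree K)] at h1
    have h2 := diam_le_sup' S (BallTree.mk a t : KTree K)
    rw [dist_eq] at hT
    rw [diam_mk] at h2 hT
    rw [max_eq_right h2] at h1
    linarith

/-- A point of the tree is determined by its mutual positions with the points of `K`. -/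
theorem ext_sup {S T : KTree K} (h : ∀ x : K, sup (ofPoint x) S = sup (ofPoint x) T) :
    S = T := by
  -- A point `a` with `sup {a, S}` close to `diam S` is equally close to `T`, so the ultrametric
  -- inequality through `a` bounds `sup {S, T}`.
  have key : ∀ S T : KTree K, (∀ x : K, sup (ofPoint x) S = sup (ofPoint x) T) →
      sup S T ≤ diam S := by
    intro S T h
    refine le_of_forall_gt fun r hr => ?_
    obtain ⟨a, ha⟩ := exists_sup_ofPoint_lt S hr
    have := sup_ultra S (ofPoint a) T
    rw [sup_comm S (ofPoint a), ← h a, max_self] at this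
    exact this.trans_lt ha
  refine eq_of_sup_le (key S T h) ?_
  rw [sup_comm]
  exact key T S fun x => (h x).symm

/-- If the ball of radius `diam S` around a point of `K` contains `S`, it is `S`. -/
theorem eq_mk_of_sup_eq_diam {S : KTree K} {a : K} (h : sup (ofPoint a) S = diam S) :
    S = (BallTree.mk a (diam S).toNNReal : KTree K) := by
  have h1 := sup_ultra S (ofPoint a) (BallTree.mk a (diam S).toNNReal : KTree K)
  rw [sup_comm S (ofPoint a), sup_ofPoint_coe, h, sub_self, norm_zero, Real.coe_toNNReal _ (diam_nonneg S),
    max_eq_left (diam_nonneg S), max_self] at h1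
  exact eq_of_sup_le h1 (by rwa [diam_mk, Real.coe_toNNReal _ (diam_nonneg S)])

end

section

variable {K : Type*} [DenselyNormedField K] [IsUltrametricDist K]

/-- The filter on `K` of the approximations of a point of the tree from above. -/
def above (S : KTree K) : Filter K :=
  comap (fun z => sup (ofPoint z) S) (𝓝[>] (diam S))

/-- If `sup {a, S} < t` and `z` lies on the sphere of radius `t` around `a`, then `sup {z, S} = t`;
density of the value group supplies such `t` arbitrarily close to `diam S`. -/
instance above_neBot (S : KTree K) : (above S).NeBot := by
  rw [above, comap_neBot_iff]
  intro U hU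
  obtain ⟨r, hr : diam S < r, hU⟩ := mem_nhdsGT_iff_exists_Ioo_subset.1 hU
  obtain ⟨a, ha⟩ := exists_sup_ofPoint_lt S hr
  have h0 := (diam_nonneg S).trans (diam_le_sup' (ofPoint a) S)
  obtain ⟨t, ht, h1, h2⟩ := exists_valueGroup_between (K := K) ha (h0.trans_lt ha)
  obtain ⟨z, hz⟩ := exists_norm_eq_of_mem a ht
  have h3 := sup_ofPoint_ultra z a S
  have h4 := norm_sub_le_sup z a S
  rw [hz] at h3 h4
  rw [max_eq_left h1.le] at h3
  have h5 := (le_max_iff.1 h4).resolve_right (not_le.2 h1)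
  exact ⟨z, hU ⟨(diam_le_sup' _ _).trans_lt (h1.trans_le h5), h3.trans_lt h2⟩⟩

/-- In the triangle `x`, `z`, `S` the two largest sides are equal. If `x` is a center of `S`, then
`sup {z, S} > diam S` forces `‖z - x‖` to be at least as large; otherwise `z` eventually comes
closer to `S` than `x` does. -/
theorem eventually_above_ge (S : KTree K) (x : K) :
    ∀ᶠ z in above S, sup (ofPoint x) S ≤ ‖z - x‖ := by
  have hd := diam_le_sup' (ofPoint x) S
  rcases hd.eq_or_lt with h | h
  · filter_upwards [preimage_mem_comap self_mem_nhdsWithin] with z (hz : diam S < _)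
    have h2 := sup_ofPoint_ultra z x S
    rw [h] at hz
    exact hz.le.trans ((le_max_iff.1 h2).resolve_right (not_le.2 hz))
  · filter_upwards [preimage_mem_comap (Ioo_mem_nhdsGT h)] with z hz
    have h2 := sup_ofPoint_ultra x z S
    rw [norm_sub_rev] at h2
    exact (le_max_iff.1 h2).resolve_right (not_le.2 hz.2)

theorem eventually_above_lt (S : KTree K) (x : K) {r : ℝ} (hr : sup (ofPoint x) S < r) :
    ∀ᶠ z in above S, ‖z - x‖ < r := by
  filter_upwards [preimage_mem_comap
    (Ioo_mem_nhdsGT ((diam_le_sup' (ofPoint x) S).trans_lt hr))] with z hz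
  exact (norm_sub_le_sup z x S).trans_lt (max_lt hz.2 hr)

theorem eventually_below_le {S : KTree K} {x : K} (h : sup (ofPoint x) S = diam S) (y : K) :
    ∀ᶠ z in below x (diam S), ‖z - y‖ ≤ sup (ofPoint y) S := by
  filter_upwards [eventually_below_lt x (diam S)] with z hz
  have h1 := norm_sub_le_sup x y S
  rw [h, max_eq_right (diam_le_sup' _ _)] at h1
  exact (norm_sub_le_max' z x y).trans (max_le (hz.le.trans (diam_le_sup' _ _)) h1)

/-- When `y` lies strictly inside the ball, points near enough to the boundary satisfy `‖z - y‖ = ‖z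
- x‖`; when it does not, every `z` strictly inside satisfies `‖z - y‖ = ‖x - y‖`. -/
theorem eventually_below_gt {S : KTree K} {x : K} (h : sup (ofPoint x) S = diam S) (y : K)
    {r : ℝ} (hr : r < sup (ofPoint y) S) : ∀ᶠ z in below x (diam S), r < ‖z - y‖ := by
  have h2 := sup_ofPoint_ultra y x S
  rw [h] at h2
  rcases lt_or_ge ‖x - y‖ (diam S) with hlt | hge
  · rw [norm_sub_rev] at h2
    rw [max_eq_right hlt.le] at h2
    filter_upwards [preimage_mem_comap
      (Ioo_mem_nhdsLT (max_lt (hr.trans_le h2) hlt))] with z hz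
    have h3 := norm_sub_le_max' z y x
    rw [norm_sub_rev y x] at h3
    have h4 : max r ‖x - y‖ < ‖z - x‖ := hz.1
    rcases le_max_iff.1 h3 with h5 | h5
    · exact (le_max_left _ _).trans_lt (h4.trans_le h5)
    · exact absurd ((le_max_right _ _).trans_lt h4) (not_lt.2 h5)
  · rw [norm_sub_rev, max_eq_left hge] at h2
    filter_upwards [eventually_below_lt x (diam S)] with z hz
    have h3 := norm_sub_le_max' x z y
    rw [norm_sub_rev x z] at h3
    exact hr.trans_le (h2.trans ((le_max_iff.1 h3).resolve_left (not_le.2 (hz.trans_le hge))))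

end

end KTree

end BerkLine

end

noncomputable section

namespace BerkLine

/-! ### Balls with arbitrary radii -/

section

variable {K : Type*} [NormedField K]

/-- The set `{|z - x| < r}`, in the projective line. -/
def oB (x : K) (r : ℝ) : Set (P1 K) := P1.of '' {z | ‖z - x‖ < r}

/-- The set `{|z - x| ≤ r}`, in the projective line. -/
def cB (x : K) (r : ℝ) : Set (P1 K) := P1.of '' {z | ‖z - x‖ ≤ r}

theorem of_mem_oB {x z : K} {r : ℝ} : P1.of z ∈ oB x r ↔ ‖z - x‖ < r := of_mem_image

theorem of_mem_cB {x z : K} {r : ℝ} : P1.of z ∈ cB x r ↔ ‖z - x‖ ≤ r := of_mem_image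

theorem infty_notMem_oB {x : K} {r : ℝ} : P1.infty K ∉ oB x r := infty_notMem_image

theorem infty_notMem_cB {x : K} {r : ℝ} : P1.infty K ∉ cB x r := infty_notMem_image

theorem oB_subset_cB (x : K) {r s : ℝ} (h : r ≤ s) : oB x r ⊆ cB x s :=
  image_mono fun z (hz : ‖z - x‖ < r) => hz.le.trans h

theorem oB_mono (x : K) {r s : ℝ} (h : r ≤ s) : oB x r ⊆ oB x s :=
  image_mono fun z (hz : ‖z - x‖ < r) => hz.trans_le h

theorem cB_subset_oB (x : K) {r s : ℝ} (h : r < s) : cB x r ⊆ oB x s :=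
  image_mono fun z (hz : ‖z - x‖ ≤ r) => hz.trans_lt h

theorem cB_mono (x : K) {r s : ℝ} (h : r ≤ s) : cB x r ⊆ cB x s :=
  image_mono fun z (hz : ‖z - x‖ ≤ r) => hz.trans h

theorem isOpenBall_oB (x : K) {r : ℝ} (hr : r ∈ valueGroup K) : IsOpenBall (oB x r) :=
  Or.inl ⟨_, ⟨x, r, hr, rfl⟩, rfl⟩

theorem isOpenBall_compl_cB (x : K) {r : ℝ} (hr : r ∈ valueGroup K) : IsOpenBall (cB x r)ᶜ :=
  Or.inr ⟨_, ⟨x, r, hr, rfl⟩, rfl⟩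

end

section

variable {K : Type*} [DenselyNormedField K]

theorem oB_eq_cB (x : K) {r : ℝ} (hr : 0 < r) (hv : r ∉ valueGroup K) : oB x r = cB x r := by
  unfold oB cB
  simp only [norm_le_iff_lt_of_notMem hr hv]

theorem isBallK_lt (x : K) {r : ℝ} (hr : 0 < r) : IsBallK {z : K | ‖z - x‖ < r} := by
  by_cases hv : r ∈ valueGroup K
  · exact Or.inl ⟨x, r, hv, rfl⟩
  · exact Or.inr (Or.inr ⟨x, r, hr, hv, by simp only [norm_le_iff_lt_of_notMem hr hv]⟩)

/-- Strict and large inequalities agree for irrational radii, so the two kinds merge into one family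
where the radius is any positive real, as for the balls of the tree. -/
theorem isOpenBall_or_isIrrationalBall_iff {B : Set (P1 K)} :
    IsOpenBall B ∨ IsIrrationalBall B ↔
      (∃ x r, 0 < r ∧ B = oB x r) ∨ ∃ x r, 0 < r ∧ B = (cB x r)ᶜ := by
  constructor
  · rintro ((⟨_, ⟨x, r, hr, rfl⟩, rfl⟩ | ⟨_, ⟨x, r, hr, rfl⟩, rfl⟩) |
      (⟨_, ⟨x, r, hr, hv, rfl⟩, rfl⟩ | ⟨_, ⟨x, r, hr, hv, rfl⟩, rfl⟩))
    · exact Or.inl ⟨x, r, valueGroup_pos hr, rfl⟩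
    · exact Or.inr ⟨x, r, valueGroup_pos hr, rfl⟩
    · exact Or.inl ⟨x, r, hr, (oB_eq_cB x hr hv).symm⟩
    · exact Or.inr ⟨x, r, hr, rfl⟩
  · rintro (⟨x, r, hr, rfl⟩ | ⟨x, r, hr, rfl⟩) <;> by_cases hv : r ∈ valueGroup K
    · exact Or.inl (isOpenBall_oB x hv)
    · rw [oB_eq_cB x hr hv]
      exact Or.inr (Or.inl ⟨_, ⟨x, r, hr, hv, rfl⟩, rfl⟩)
    · exact Or.inl (isOpenBall_compl_cB x hv)
    · exact Or.inr (Or.inr ⟨_, ⟨x, r, hr, hv, rfl⟩, rfl⟩)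

theorem isClosedBall_compl_iff {B : Set (P1 K)} : IsClosedBall Bᶜ ↔ IsOpenBall B := by
  constructor
  · rintro (⟨C, hC, h⟩ | ⟨C, hC, h⟩)
    · exact Or.inr ⟨C, hC, by rw [← h, compl_compl]⟩
    · exact Or.inl ⟨C, hC, compl_injective h⟩
  · rintro (⟨C, hC, rfl⟩ | ⟨C, hC, rfl⟩)
    · exact Or.inr ⟨C, hC, rfl⟩
    · exact Or.inl ⟨C, hC, compl_compl _⟩

theorem isIrrationalBall_compl_iff {B : Set (P1 K)} :
    IsIrrationalBall Bᶜ ↔ IsIrrationalBall B := by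
  constructor
  · rintro (⟨C, hC, h⟩ | ⟨C, hC, h⟩)
    · exact Or.inr ⟨C, hC, by rw [← h, compl_compl]⟩
    · exact Or.inl ⟨C, hC, compl_injective h⟩
  · rintro (⟨C, hC, rfl⟩ | ⟨C, hC, rfl⟩)
    · exact Or.inr ⟨C, hC, rfl⟩
    · exact Or.inl ⟨C, hC, compl_compl _⟩

/-- Density of the value group is essential: it puts a point of `K` on a sphere of radius strictly
between `s` and `r`. -/
theorem le_of_ball_subset {a : K} {r s : ℝ} (hr : 0 < r)
    (h : {w | ‖w - a‖ ≤ r} ⊆ {w : K | ‖w - a‖ ≤ s}) : r ≤ s := by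
  by_contra hlt
  rw [not_le] at hlt
  obtain ⟨t, ht, h1, h2⟩ := exists_valueGroup_between (K := K) hlt hr
  obtain ⟨z, rfl⟩ := exists_norm_eq_of_mem a ht
  exact h1.not_ge (h h2.le)

/-- Two radii of the value group fit between `r` and `s`; the open ball of the larger one overlaps
the complement of the closed ball of the smaller one. This turns balls of arbitrary real radius into
genuine open balls. -/
theorem exists_cover_of_lt (x : K) {r s : ℝ} (hrs : r < s) (hs : 0 < s) :
    ∃ E E' : Set (P1 K), IsOpenBall E ∧ IsOpenBall E' ∧ E ∪ E' = univ ∧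
      E ⊆ oB x s ∧ E' ⊆ (cB x r)ᶜ := by
  obtain ⟨u, hu, hru, hus⟩ := exists_valueGroup_between (K := K) hrs hs
  obtain ⟨t, ht, hrt, htu⟩ := exists_valueGroup_between (K := K) hru (valueGroup_pos hu)
  refine ⟨oB x u, (cB x t)ᶜ, isOpenBall_oB x hu, isOpenBall_compl_cB x ht,
    eq_univ_of_forall fun p => ?_, oB_mono x hus.le, compl_subset_compl.2 (cB_mono x hrt.le)⟩
  by_cases hp : p ∈ cB x t
  · exact Or.inl (cB_subset_oB x htu hp)
  · exact Or.inr hp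

end

/-! ### Balls of the projective tree, their traces and the filter of a point -/

namespace ProjTree

section

variable {K : Type*} [NormedField K] [IsUltrametricDist K]

/-- The open balls of the tree of `K`, in the projective tree. -/
def oBall (x : K) (r : ℝ) : Set (ProjTree K) := of '' {S | KTree.sup (KTree.ofPoint x) S < r}

/-- The closed balls of the tree of `K`, in the projective tree. -/
def cBall (x : K) (r : ℝ) : Set (ProjTree K) := of '' {S | KTree.sup (KTree.ofPoint x) S ≤ r}

theorem of_injective : Function.Injective (of : KTree K → ProjTree K) :=
  fun _ _ h => by injection h

theorem of_mem_oBall {x : K} {r : ℝ} {S : KTree K} :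
    of S ∈ oBall x r ↔ KTree.sup (KTree.ofPoint x) S < r := of_injective.mem_set_image

theorem of_mem_cBall {x : K} {r : ℝ} {S : KTree K} :
    of S ∈ cBall x r ↔ KTree.sup (KTree.ofPoint x) S ≤ r := of_injective.mem_set_image

theorem infty_notMem_oBall {x : K} {r : ℝ} : infty ∉ oBall x r := by rintro ⟨S, -, ⟨⟩⟩

theorem infty_notMem_cBall {x : K} {r : ℝ} : infty ∉ cBall x r := by rintro ⟨S, -, ⟨⟩⟩

theorem isOpenBall_iff {D : Set (ProjTree K)} :
    IsOpenBall D ↔ (∃ x r, 0 < r ∧ D = oBall x r) ∨ ∃ x r, 0 < r ∧ D = (cBall x r)ᶜ := by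
  constructor
  · rintro (⟨_, ⟨x, r, hr, rfl⟩, rfl⟩ | ⟨_, ⟨x, r, hr, rfl⟩, rfl⟩)
    · exact Or.inl ⟨x, r, hr, rfl⟩
    · exact Or.inr ⟨x, r, hr, rfl⟩
  · rintro (⟨x, r, hr, rfl⟩ | ⟨x, r, hr, rfl⟩)
    · exact Or.inl ⟨_, ⟨x, r, hr, rfl⟩, rfl⟩
    · exact Or.inr ⟨_, ⟨x, r, hr, rfl⟩, rfl⟩

theorem isOpenBall_compl_iff {D : Set (ProjTree K)} : IsOpenBall Dᶜ ↔ IsClosedBall D := by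
  constructor
  · rintro (⟨E, hE, h⟩ | ⟨E, hE, h⟩)
    · exact Or.inr ⟨E, hE, compl_eq_comm.1 h |>.symm⟩
    · exact Or.inl ⟨E, hE, compl_injective h⟩
  · rintro (⟨E, hE, rfl⟩ | ⟨E, hE, rfl⟩)
    · exact Or.inr ⟨E, hE, rfl⟩
    · exact Or.inl ⟨E, hE, compl_compl _⟩

theorem of_mem_trace {D : Set (ProjTree K)} {z : K} :
    P1.of z ∈ trace D ↔ of (KTree.ofPoint z) ∈ D := by
  constructor
  · rintro (⟨x, h, hx⟩ | ⟨h, -⟩)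
    · rwa [P1.of_injective h]
    · exact absurd h (P1.of_ne_infty z)
  · exact fun h => Or.inl ⟨z, rfl, h⟩

theorem infty_mem_trace {D : Set (ProjTree K)} : P1.infty K ∈ trace D ↔ infty ∈ D := by
  constructor
  · rintro (⟨x, h, hx⟩ | ⟨-, h⟩)
    · exact absurd h.symm (P1.of_ne_infty x)
    · exact h
  · exact fun h => Or.inr ⟨rfl, h⟩

theorem trace_compl (D : Set (ProjTree K)) : trace Dᶜ = (trace D)ᶜ := by
  ext p
  rcases P1.eq_infty_or_of p with rfl | ⟨x, rfl⟩
  · rw [mem_compl_iff, infty_mem_trace, infty_mem_trace, mem_compl_iff]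
  · rw [mem_compl_iff, of_mem_trace, of_mem_trace, mem_compl_iff]

theorem trace_oBall (x : K) (r : ℝ) : trace (oBall x r) = oB x r := by
  ext p
  rcases P1.eq_infty_or_of p with rfl | ⟨z, rfl⟩
  · rw [infty_mem_trace]
    exact iff_of_false infty_notMem_oBall infty_notMem_oB
  · rw [of_mem_trace, of_mem_oBall, of_mem_oB, KTree.sup_ofPoint, norm_sub_rev]

theorem trace_cBall (x : K) (r : ℝ) : trace (cBall x r) = cB x r := by
  ext p
  rcases P1.eq_infty_or_of p with rfl | ⟨z, rfl⟩
  · rw [infty_mem_trace]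
    exact iff_of_false infty_notMem_cBall infty_notMem_cB
  · rw [of_mem_trace, of_mem_cBall, of_mem_cB, KTree.sup_ofPoint, norm_sub_rev]

/-- The filter on the projective line generated by the traces of the open balls that contain a
point of the projective tree. -/
def filter (P : ProjTree K) : Filter (P1 K) :=
  Filter.generate {B | ∃ D, IsOpenBall D ∧ P ∈ D ∧ trace D = B}

theorem le_filter_iff {P : ProjTree K} {F : Filter (P1 K)} :
    F ≤ P.filter ↔ (∀ x r, 0 < r → P ∈ oBall x r → oB x r ∈ F) ∧
      ∀ x r, 0 < r → P ∉ cBall x r → (cB x r)ᶜ ∈ F := by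
  rw [filter, le_generate_iff]
  constructor
  · intro h
    refine ⟨fun x r hr hP => h ⟨_, isOpenBall_iff.2 (Or.inl ⟨x, r, hr, rfl⟩), hP,
      trace_oBall x r⟩, fun x r hr hP => h ⟨_, isOpenBall_iff.2 (Or.inr ⟨x, r, hr, rfl⟩), hP, ?_⟩⟩
    rw [trace_compl, trace_cBall]
  · rintro ⟨h1, h2⟩ _ ⟨D, hD, hP, rfl⟩
    rcases isOpenBall_iff.1 hD with ⟨x, r, hr, rfl⟩ | ⟨x, r, hr, rfl⟩
    · rw [trace_oBall]
      exact h1 x r hr hP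
    · rw [trace_compl, trace_cBall]
      exact h2 x r hr hP

theorem oB_mem_filter {P : ProjTree K} {x : K} {r : ℝ} (hr : 0 < r) (h : P ∈ oBall x r) :
    oB x r ∈ P.filter := (le_filter_iff.1 le_rfl).1 x r hr h

theorem compl_cB_mem_filter {P : ProjTree K} {x : K} {r : ℝ} (hr : 0 < r) (h : P ∉ cBall x r) :
    (cB x r)ᶜ ∈ P.filter := (le_filter_iff.1 le_rfl).2 x r hr h

end

section

variable {K : Type*} [DenselyNormedField K] [IsUltrametricDist K]

theorem pure_infty_le_filter : pure (P1.infty K) ≤ (infty : ProjTree K).filter :=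
  le_filter_iff.2 ⟨fun _ _ _ h => absurd h infty_notMem_oBall, fun _ _ _ _ => infty_notMem_cB⟩

/-- Besides making `filter` proper, this gives test points in `K`: any set of the filter contains
points approaching `S` from above. -/
theorem map_above_le_filter (S : KTree K) : map P1.of S.above ≤ (of S).filter := by
  refine le_filter_iff.2 ⟨fun x r _ h => ?_, fun x r _ h => ?_⟩
  · rw [mem_map]
    filter_upwards [S.eventually_above_lt x (of_mem_oBall.1 h)] with z hz
    exact of_mem_oB.2 hz
  · rw [mem_map]
    filter_upwards [S.eventually_above_ge x] with z hz hz'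
    exact h (of_mem_cBall.2 (hz.trans (of_mem_cB.1 hz')))

theorem map_below_le_filter {S : KTree K} {x : K}
    (h : KTree.sup (KTree.ofPoint x) S = KTree.diam S) :
    map P1.of (below x S.diam) ≤ (of S).filter := by
  refine le_filter_iff.2 ⟨fun y r _ hr => ?_, fun y r _ hr => ?_⟩
  · rw [mem_map]
    filter_upwards [KTree.eventually_below_le h y] with z hz
    exact of_mem_oB.2 (hz.trans_lt (of_mem_oBall.1 hr))
  · rw [of_mem_cBall, not_le] at hr
    rw [mem_map]
    filter_upwards [KTree.eventually_below_gt h y hr] with z hz hz'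
    exact hz.not_ge (of_mem_cB.1 hz')

instance filter_neBot (P : ProjTree K) : P.filter.NeBot := by
  rcases P with S | _
  · exact NeBot.mono inferInstance (map_above_le_filter S)
  · exact NeBot.mono inferInstance pure_infty_le_filter

theorem oB_mem_filter_iff {P : ProjTree K} {x : K} {r : ℝ} (hr : 0 < r) :
    oB x r ∈ P.filter ↔ P ∈ oBall x r := by
  refine ⟨fun h => ?_, oB_mem_filter hr⟩
  rcases P with S | _
  · by_contra hS
    rw [of_mem_oBall, not_lt] at hS
    obtain ⟨z, hz1, hz2⟩ := ((S.eventually_above_ge x).and (map_above_le_filter S h)).exists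
    exact (of_mem_oB.1 hz2).not_ge (hS.trans hz1)
  · exact absurd (pure_infty_le_filter h) infty_notMem_oB

/-- Only the boundary case `sup {x, S} = r` is delicate. If `diam S < r`, approximations of `S` from
above fall into the closed ball. If `diam S = r`, they stay outside it, and approximations from
below are needed instead. -/
theorem compl_cB_mem_filter_iff {P : ProjTree K} {x : K} {r : ℝ} (hr : 0 < r) :
    (cB x r)ᶜ ∈ P.filter ↔ P ∉ cBall x r := by
  refine ⟨fun h => ?_, compl_cB_mem_filter hr⟩
  rcases P with S | _
  · rw [of_mem_cBall]
    intro hS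
    rcases hS.lt_or_eq with hlt | heq
    · obtain ⟨p, hp1, hp2⟩ := Filter.nonempty_of_mem
        (inter_mem h (oB_mem_filter (P := of S) hr (of_mem_oBall.2 hlt)))
      exact hp1 (oB_subset_cB x le_rfl hp2)
    · rcases (KTree.diam_le_sup' (KTree.ofPoint x) S).lt_or_eq with hd | hd
      · obtain ⟨z, hz1, hz2⟩ := ((show ∀ᶠ z in S.above, KTree.sup (KTree.ofPoint z) S <
          KTree.sup (KTree.ofPoint x) S from preimage_mem_comap
            (mem_of_superset (Ioo_mem_nhdsGT hd) fun _ h => h.2)).and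
              (map_above_le_filter S h)).exists
        refine hz2 (of_mem_cB.2 ?_)
        exact (KTree.norm_sub_le_sup z x S).trans (max_le (hz1.le.trans hS) hS)
      · have := below_neBot x (hd.symm ▸ heq.symm ▸ hr : 0 < S.diam)
        obtain ⟨z, hz1, hz2⟩ := ((eventually_below_lt x S.diam).and
          (map_below_le_filter hd.symm h)).exists
        exact hz2 (of_mem_cB.2 (hz1.le.trans (hd.le.trans hS)))
  · exact infty_notMem_cBall

theorem trace_mem_filter_iff {P : ProjTree K} {D : Set (ProjTree K)} (hD : IsOpenBall D) :
    trace D ∈ P.filter ↔ P ∈ D := by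
  rcases isOpenBall_iff.1 hD with ⟨x, r, hr, rfl⟩ | ⟨x, r, hr, rfl⟩
  · rw [trace_oBall, oB_mem_filter_iff hr]
  · rw [trace_compl, trace_cBall, compl_cB_mem_filter_iff hr, mem_compl_iff]

theorem eq_of_trace_eq {D D' : Set (ProjTree K)} (hD : IsOpenBall D) (hD' : IsOpenBall D')
    (h : trace D = trace D') : D = D' := by
  ext P
  rw [← trace_mem_filter_iff hD, h, trace_mem_filter_iff hD']

theorem isOpenBall_or_isIrrationalBall_iff {B : Set (P1 K)} :
    BerkLine.IsOpenBall B ∨ IsIrrationalBall B ↔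
      ∃ D : Set (ProjTree K), IsOpenBall D ∧ trace D = B := by
  rw [BerkLine.isOpenBall_or_isIrrationalBall_iff]
  constructor
  · rintro (⟨x, r, hr, rfl⟩ | ⟨x, r, hr, rfl⟩)
    · exact ⟨_, isOpenBall_iff.2 (Or.inl ⟨x, r, hr, rfl⟩), trace_oBall x r⟩
    · exact ⟨_, isOpenBall_iff.2 (Or.inr ⟨x, r, hr, rfl⟩), by rw [trace_compl, trace_cBall]⟩
  · rintro ⟨D, hD, rfl⟩
    rcases isOpenBall_iff.1 hD with ⟨x, r, hr, rfl⟩ | ⟨x, r, hr, rfl⟩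
    · exact Or.inl ⟨x, r, hr, trace_oBall x r⟩
    · exact Or.inr ⟨x, r, hr, by rw [trace_compl, trace_cBall]⟩

theorem isClosedBall_or_isIrrationalBall_iff {B : Set (P1 K)} :
    BerkLine.IsClosedBall B ∨ IsIrrationalBall B ↔
      ∃ D : Set (ProjTree K), IsClosedBall D ∧ trace D = B := by
  rw [← compl_compl B, isClosedBall_compl_iff, isIrrationalBall_compl_iff,
    isOpenBall_or_isIrrationalBall_iff]
  constructor
  · rintro ⟨D, hD, h⟩
    refine ⟨Dᶜ, isOpenBall_compl_iff.1 (by rwa [compl_compl]), by rw [trace_compl, h]⟩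
  · rintro ⟨D, hD, h⟩
    exact ⟨Dᶜ, isOpenBall_compl_iff.2 hD, by rw [trace_compl, h, compl_compl]⟩

/-- The open balls around `x` containing `S` determine `sup {x, S}`, and these numbers determine
`S`; infinity is the only point lying in no ball of the tree. -/
theorem filter_injective : Function.Injective (filter : ProjTree K → Filter (P1 K)) := by
  intro P Q h
  have key : ∀ x r, 0 < r → (P ∈ oBall x r ↔ Q ∈ oBall x r) := fun x r hr => by
    rw [← oB_mem_filter_iff hr, h, oB_mem_filter_iff hr]
  have hpos : ∀ S : KTree K, 0 < KTree.sup (KTree.ofPoint 0) S + 1 := fun S =>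
    add_pos_of_nonneg_of_pos (sup_nonneg _ _) one_pos
  rcases P with S | _ <;> rcases Q with T | _
  · refine congrArg of (KTree.ext_sup fun x => eq_of_forall_gt_iff fun r => ?_)
    rcases lt_or_ge 0 r with hr | hr
    · have := key x r hr
      rwa [of_mem_oBall, of_mem_oBall] at this
    · exact iff_of_false (hr.trans (sup_nonneg _ _)).not_gt (hr.trans (sup_nonneg _ _)).not_gt
  · exact absurd ((key 0 _ (hpos S)).1 (of_mem_oBall.2 (lt_add_one _))) infty_notMem_oBall
  · exact absurd ((key 0 _ (hpos T)).2 (of_mem_oBall.2 (lt_add_one _))) infty_notMem_oBall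
  · rfl

/-- A neighbourhood of a point of the projective tree belongs to a covering by two open balls
the other of which misses a set of the filter. -/
theorem exists_cover_of_mem {P : ProjTree K} {D : Set (ProjTree K)} (hD : IsOpenBall D)
    (hP : P ∈ D) : ∃ E E' : Set (P1 K), BerkLine.IsOpenBall E ∧ BerkLine.IsOpenBall E' ∧
      E ∪ E' = univ ∧ E ⊆ trace D ∧ E'ᶜ ∈ P.filter := by
  rcases isOpenBall_iff.1 hD with ⟨x, r, hr, rfl⟩ | ⟨x, r, hr, rfl⟩
  · obtain ⟨S, hS : _ < r, rfl⟩ := hP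
    -- The strict inequality leaves room for a smaller radius: the point still lies in the ball of
    -- radius `s`, which misses `E'`.
    obtain ⟨s, hSs, hsr⟩ := exists_between hS
    obtain ⟨E, E', h1, h2, h3, h4, h5⟩ := exists_cover_of_lt x hsr hr
    refine ⟨E, E', h1, h2, h3, by rwa [trace_oBall], ?_⟩
    refine mem_of_superset (oB_mem_filter ((sup_nonneg _ _).trans_lt hSs) (of_mem_oBall.2 hSs)) ?_
    exact (oB_subset_cB x le_rfl).trans (subset_compl_comm.1 h5)
  · have hs : ∃ s, r < s ∧ P ∉ cBall x s := by
      rcases P with S | _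
      · rw [mem_compl_iff, of_mem_cBall, not_le] at hP
        obtain ⟨s, h1, h2⟩ := exists_between hP
        exact ⟨s, h1, by rwa [of_mem_cBall, not_le]⟩
      · exact ⟨r + 1, lt_add_one r, infty_notMem_cBall⟩
    obtain ⟨s, hrs, hs⟩ := hs
    obtain ⟨E, E', h1, h2, h3, h4, h5⟩ := exists_cover_of_lt x hrs (hr.trans hrs)
    refine ⟨E', E, h2, h1, by rwa [union_comm], by rwa [trace_compl, trace_cBall], ?_⟩
    exact mem_of_superset (compl_cB_mem_filter (hr.trans hrs) hs)
      (compl_subset_compl.2 (h4.trans (oB_subset_cB x le_rfl)))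

end

end ProjTree

end BerkLine

end

noncomputable section

namespace BerkLine

/-! ### Cauchy filters on the projective line -/

section

variable {K : Type*} [NormedField K]

theorem isAffinoidCover_pair {E E' : Set (P1 K)} (hE : IsOpenBall E) (hE' : IsOpenBall E')
    (h : E ∪ E' = univ) : IsAffinoidCover {E, E'} :=
  ⟨toFinite _, by rintro _ (rfl | rfl); exacts [hE.isOpenAffinoid, hE'.isOpenAffinoid],
    by rw [sUnion_pair, h]⟩

theorem coverRel_mem_prod {C : Set (Set (P1 K))} {F G : Filter (P1 K)}
    (h : ∃ Y ∈ C, Y ∈ F ⊔ G) : coverRel C ∈ F ×ˢ G := by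
  obtain ⟨Y, hY, hF, hG⟩ := h
  exact mem_of_superset (prod_mem_prod hF hG) (subset_biUnion_of_mem (u := fun Y => Y ×ˢ Y) hY)

theorem norm_sub_lt_of_mem [IsUltrametricDist K] {F : Filter (P1 K)} [F.NeBot]
    {x y : K} {r s : ℝ} (hx : oB x r ∈ F) (hy : oB y s ∈ F) : ‖x - y‖ < max r s := by
  obtain ⟨_, ⟨z, hz : ‖z - x‖ < r, rfl⟩, hz'⟩ := Filter.nonempty_of_mem (inter_mem hx hy)
  have := norm_sub_le_max' x z y
  rw [norm_sub_rev x z] at this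
  exact this.trans_lt (max_lt_max hz (of_mem_oB.1 hz'))

end

section

variable {K : Type*} [DenselyNormedField K] [IsUltrametricDist K] [Infinite (ResField K)]

/-- A filter contains a member of a given covering by open affinoids as soon as it contains a
member of each of finitely many suitable coverings by two open balls. -/
theorem IsAffinoidCover.exists_pairs {C : Set (Set (P1 K))} (hC : IsAffinoidCover C) :
    ∃ T : Set (Set (P1 K) × Set (P1 K)), T.Finite ∧
      (∀ p ∈ T, IsOpenBall p.1 ∧ IsOpenBall p.2 ∧ p.1 ∪ p.2 = univ) ∧
      ∀ F : Filter (P1 K), (∀ p ∈ T, p.1 ∈ F ∨ p.2 ∈ F) → ∃ Y ∈ C, Y ∈ F := by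
  obtain ⟨hfin, haff, hcov⟩ := hC
  choose! s hs hb he using haff
  have hS : (⋃ Y ∈ C, s Y).Finite := hfin.biUnion hs
  have hSb : ∀ D ∈ ⋃ Y ∈ C, s Y, IsOpenBall D := by
    intro D hD
    obtain ⟨Y, hY, hD⟩ := mem_iUnion₂.1 hD
    exact hb Y hY D hD
  refine ⟨{p ∈ (⋃ Y ∈ C, s Y) ×ˢ (⋃ Y ∈ C, s Y) | p.1 ∪ p.2 = univ},
    (hS.prod hS).subset (sep_subset _ _),
    fun p hp => ⟨hSb _ hp.1.1, hSb _ hp.1.2, hp.2⟩, fun F hF => ?_⟩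
  -- If no member of `C` is in `F`, each member `Y` is contained in a ball `d Y` of its presentation
  -- that is not in `F`. These balls cover, hence two of them do, and `F` contains one of the two.
  by_contra hno
  push Not at hno
  have hd : ∀ Y ∈ C, ∃ D ∈ s Y, D ∉ F := by
    intro Y hY
    by_contra hall
    push Not at hall
    exact hno Y hY (he Y hY ▸ (sInter_mem (hs Y hY)).2 hall)
  choose! d hd hdF using hd
  have hdS : ∀ Y ∈ C, d Y ∈ ⋃ Y ∈ C, s Y := fun Y hY => mem_iUnion₂.2 ⟨Y, hY, hd Y hY⟩
  obtain ⟨_, ⟨Y, hY, rfl⟩, _, ⟨Y', hY', rfl⟩, h⟩ :=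
    exists_pair_cover (S := d '' C) (hfin.image d)
      (by rintro _ ⟨Y, hY, rfl⟩; exact hSb _ (hdS Y hY))
      (by
        refine eq_univ_of_forall fun y => ?_
        obtain ⟨Y, hY, hy⟩ : y ∈ ⋃₀ C := hcov ▸ mem_univ y
        rw [he Y hY] at hy
        exact ⟨d Y, ⟨Y, hY, rfl⟩, hy _ (hd Y hY)⟩)
  rcases hF (d Y, d Y') ⟨⟨hdS Y hY, hdS Y' hY'⟩, h⟩ with h | h
  · exact hdF Y hY h
  · exact hdF Y' hY' h

/-- A small set of `F` lies in the star of any of its points for a star refinement of the covering,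
hence inside `E` or inside `E'`. -/
theorem Cauchy.mem_or_mem {F : Filter (P1 K)} (hF : Cauchy F) {E E' : Set (P1 K)}
    (hE : IsOpenBall E) (hE' : IsOpenBall E') (h : E ∪ E' = univ) : E ∈ F ∨ E' ∈ F := by
  obtain ⟨C, hC, hstar⟩ := exists_star_refinement (isAffinoidCover_pair hE hE' h)
  obtain ⟨hne, hF⟩ := cauchy_iff.1 hF
  obtain ⟨A, hA, hAC⟩ := hF _ (mem_uniformity_P1.2 ⟨C, hC, Subset.rfl⟩)
  obtain ⟨x, hx⟩ := Filter.nonempty_of_mem hA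
  obtain ⟨Y, hY, hsub⟩ := hstar x
  have hAY : A ⊆ Y := by
    intro y hy
    obtain ⟨Y', hY', h1, h2⟩ := mem_iUnion₂.1 (hAC (mk_mem_prod hx hy))
    exact hsub Y' hY' h1 h2
  rcases hY with rfl | rfl
  · exact Or.inl (mem_of_superset hA hAY)
  · exact Or.inr (mem_of_superset hA hAY)

theorem Cauchy.oB_mem_or {F : Filter (P1 K)} (hF : Cauchy F) (x : K) {r s : ℝ} (hrs : r < s)
    (hs : 0 < s) : oB x s ∈ F ∨ (cB x r)ᶜ ∈ F := by
  obtain ⟨E, E', h1, h2, h3, h4, h5⟩ := exists_cover_of_lt x hrs hs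
  rcases Cauchy.mem_or_mem hF h1 h2 h3 with h | h
  · exact Or.inl (mem_of_superset h h4)
  · exact Or.inr (mem_of_superset h h5)

end

/-! ### The chordal distance and coverings by two balls -/

namespace ProjTree

section

variable {K : Type*} [NormedField K] [IsUltrametricDist K]

/-- Twice the distance is the sum of the nonnegative terms `csup P Q - csup P P` and `csup P Q -
csup Q Q`, so `csup P Q` exceeds `csup Q Q`, and a fortiori `csup Q R`, by at most `2 * dist P Q`.
Thus `csup` is 2-Lipschitz in each variable. -/
theorem csup_le_add_dist (P Q R : ProjTree K) : csup P R ≤ csup Q R + 2 * dist P Q := by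
  have h : dist P Q = csup P Q - (csup P P + csup Q Q) / 2 := chordal_eq P Q
  have h1 := csup_self_le P Q
  have h2 := csup_self_le Q P
  have h3 := csup_self_le Q R
  rw [csup_comm Q P] at h2
  rcases le_max_iff.1 (csup_ultra P Q R) with h4 | h4 <;> linarith

/-- A closed ball has a uniform neighbourhood contained in a larger ball. -/
theorem exists_pos_forall_mem_oBall (x : K) {r s : ℝ} (hrs : r < s) (hs : 0 < s) :
    ∃ ε > 0, ∀ P Q : ProjTree K, dist P Q < ε → P ∈ cBall x r → Q ∈ oBall x s := by
  set X := KTree.ofPoint x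
  have hh := height_pos X
  set h := height X with hh_def
  -- The number `sup {x, S}` is the quotient of `h * csup S X` by `csup S ∞`, both Lipschitz in `S`.
  -- The constant `c` bounds the denominator from below on the closed ball of radius `r`.
  set c := min (1 / h) (1 / s)
  have hcpos : 0 < c := lt_min (by positivity) (by positivity)
  refine ⟨(s - r) * c / (2 * (h + s)), div_pos (mul_pos (sub_pos.2 hrs) hcpos) (by positivity),
    fun P Q hPQ hP => ?_⟩
  by_contra hQ
  obtain ⟨S, hS : KTree.sup X S ≤ r, rfl⟩ := hP
  have hpS := height_pos S
  have hu : h * csup (of S) (of X) = KTree.sup X S * csup (of S) infty := by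
    simp only [csup, ← hh_def]
    rw [KTree.sup_comm S]
    field_simp
  have hvpos : 0 < csup (of S) infty := by simp only [csup]; positivity
  -- Written without division, the failure of `Q ∈ oBall x s` also makes sense at infinity, where
  -- `csup` vanishes.
  have hQ' : s * csup Q infty ≤ h * csup Q (of X) := by
    rcases Q with T | _
    · have hpT := height_pos T
      have hT : s ≤ KTree.sup X T := not_lt.1 fun hlt => hQ (of_mem_oBall.2 hlt)
      simp only [csup, ← hh_def]
      rw [KTree.sup_comm T]
      field_simp
      exact hT
    · simp only [csup]
      rw [mul_zero]
      positivity
  have hur : h * csup (of S) (of X) ≤ r * csup (of S) infty := by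
    rw [hu]
    exact mul_le_mul_of_nonneg_right hS hvpos.le
  -- Since `1 / h = csup X ∞` is at most one of `csup S X` and `csup S ∞`, either the second is at
  -- least `1 / h`, or `1 ≤ h * csup S X ≤ r * csup S ∞`.
  have hcv : c ≤ csup (of S) infty := by
    have h1 := csup_ultra (of X) (of S) infty
    rw [csup_comm (of X) (of S)] at h1
    have h2 : csup (of X) infty = 1 / h := rfl
    rw [h2] at h1
    rcases le_max_iff.1 h1 with h3 | h3
    · refine (min_le_right _ _).trans ?_
      rw [div_le_iff₀ hh] at h3
      rw [div_le_iff₀ hs]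
      nlinarith
    · exact (min_le_left _ _).trans h3
  have l1 := csup_le_add_dist Q (of S) (of X)
  have l2 := csup_le_add_dist (of S) Q infty
  rw [dist_comm] at l1
  rw [lt_div_iff₀ (by positivity)] at hPQ
  have m1 := mul_le_mul_of_nonneg_left l1 hh.le
  have m2 := mul_le_mul_of_nonneg_left l2 hs.le
  -- Chaining the bounds gives `(s - r) * c ≤ 2 * (h + s) * dist P Q`, against the choice of `ε`.
  have m3 := mul_le_mul_of_nonneg_left hcv (sub_pos.2 hrs).le
  linarith

theorem mem_cBall_of_mem_cBall {P : ProjTree K} {a b : K} {r s : ℝ} (h : P ∈ cBall a r)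
    (hrs : r ≤ s) (hab : ‖a - b‖ ≤ s) : P ∈ cBall b s := by
  obtain ⟨S, hS : _ ≤ r, rfl⟩ := h
  rw [norm_sub_rev] at hab
  exact of_mem_cBall.2 ((KTree.sup_ofPoint_ultra b a S).trans (max_le hab (hS.trans hrs)))

theorem notMem_cBall_of_mem_oBall {P : ProjTree K} {a b : K} {s : ℝ}
    (h : P ∈ oBall a ‖a - b‖) (hs : s < ‖a - b‖) : P ∉ cBall b s := by
  obtain ⟨S, hS : _ < ‖a - b‖, rfl⟩ := h
  rw [of_mem_cBall]
  intro hb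
  exact (KTree.norm_sub_le_sup a b S).not_gt (max_lt hS (hb.trans_lt hs))

end

section

variable {K : Type*} [DenselyNormedField K] [IsUltrametricDist K]

/-- The closed ball of radius `r` around `a` lies in the open ball of radius `s` around `b`, with a
gap between `max r ‖a - b‖` and `s`. If one of two close points is in the former, both are in the
latter; otherwise both are in the complement of the former. -/
theorem exists_pos_forall_mem_sup_aux {a b : K} {r s : ℝ} (hr : r ∈ valueGroup K) (hs : 0 < s)
    (h : (cB a r)ᶜ ∪ oB b s = univ) : ∃ ε > 0, ∀ P Q : ProjTree K, dist P Q < ε →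
      (cB a r)ᶜ ∈ P.filter ⊔ Q.filter ∨ oB b s ∈ P.filter ⊔ Q.filter := by
  have hr0 := valueGroup_pos hr
  have hsub : ∀ z : K, ‖z - a‖ ≤ r → ‖z - b‖ < s := by
    intro z hz
    have : P1.of z ∈ (cB a r)ᶜ ∪ oB b s := h ▸ mem_univ _
    exact of_mem_oB.1 (this.resolve_left fun h => h (of_mem_cB.2 hz))
  have h1 : ‖a - b‖ < s := hsub a (by simpa using hr0.le)
  have h2 : r < s := by
    obtain ⟨z, hz⟩ := exists_norm_eq_of_mem a hr
    have := norm_sub_le_max' z b a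
    rw [hz, norm_sub_rev b a] at this
    exact this.trans_lt (max_lt (hsub z hz.le) h1)
  obtain ⟨ε, hε, H⟩ := exists_pos_forall_mem_oBall b (max_lt h2 h1) hs
  have key : ∀ P Q : ProjTree K, dist P Q < ε → P ∈ cBall a r →
      oB b s ∈ P.filter ∧ oB b s ∈ Q.filter := by
    intro P Q hPQ hP
    have hP' := mem_cBall_of_mem_cBall hP (le_max_left r ‖a - b‖) (le_max_right _ _)
    exact ⟨oB_mem_filter hs (H P P (by rwa [dist_self]) hP'), oB_mem_filter hs (H P Q hPQ hP')⟩
  refine ⟨ε, hε, fun P Q hPQ => ?_⟩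
  by_cases hP : P ∈ cBall a r
  · exact Or.inr (key P Q hPQ hP)
  by_cases hQ : Q ∈ cBall a r
  · exact Or.inr (key Q P (by rwa [dist_comm]) hQ).symm
  exact Or.inl ⟨compl_cB_mem_filter hr0 hP, compl_cB_mem_filter hr0 hQ⟩

/-- A covering of the projective line by two open balls is uniform for the chordal distance. -/
theorem exists_pos_forall_mem_sup {E E' : Set (P1 K)} (hE : BerkLine.IsOpenBall E)
    (hE' : BerkLine.IsOpenBall E') (h : E ∪ E' = univ) :
    ∃ ε > 0, ∀ P Q : ProjTree K, dist P Q < ε →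
      E ∈ P.filter ⊔ Q.filter ∨ E' ∈ P.filter ⊔ Q.filter := by
  rcases hE with ⟨_, ⟨a, r, hr, rfl⟩, rfl⟩ | ⟨_, ⟨a, r, hr, rfl⟩, rfl⟩ <;>
    rcases hE' with ⟨_, ⟨b, s, hs, rfl⟩, rfl⟩ | ⟨_, ⟨b, s, hs, rfl⟩, rfl⟩
  · exfalso
    rcases (h ▸ mem_univ _ : P1.infty K ∈ _ ∪ _) with h1 | h1 <;> exact infty_notMem_image h1
  · rw [union_comm] at h
    obtain ⟨ε, hε, H⟩ := exists_pos_forall_mem_sup_aux hs (valueGroup_pos hr) h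
    exact ⟨ε, hε, fun P Q hPQ => (H P Q hPQ).symm⟩
  · exact exists_pos_forall_mem_sup_aux hr (valueGroup_pos hs) h
  · have hr0 := valueGroup_pos hr
    have hs0 := valueGroup_pos hs
    have hdis : ∀ z : K, ‖z - a‖ ≤ r → s < ‖z - b‖ := by
      intro z hz
      by_contra hz'
      rw [not_lt] at hz'
      rcases (h ▸ mem_univ _ : P1.of z ∈ _ ∪ _) with h1 | h1
      · exact h1 (of_mem_cB.2 hz)
      · exact h1 (of_mem_cB.2 hz')
    -- The two closed balls are disjoint, so `‖a - b‖` exceeds both radii, and the open ball of this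
    -- radius around `a` separates the first from the second.
    have h1 : s < ‖a - b‖ := hdis a (by simpa using hr0.le)
    have h2 : r < ‖a - b‖ := by
      by_contra hle
      rw [not_lt, norm_sub_rev] at hle
      have := hdis b hle
      rw [sub_self, norm_zero] at this
      exact this.not_gt hs0
    obtain ⟨ε, hε, H⟩ := exists_pos_forall_mem_oBall a h2 (hr0.trans h2)
    have key : ∀ P Q : ProjTree K, dist P Q < ε → P ∈ cBall a r →
        (cB b s)ᶜ ∈ P.filter ∧ (cB b s)ᶜ ∈ Q.filter := by
      intro P Q hPQ hP
      exact ⟨compl_cB_mem_filter hs0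
        (notMem_cBall_of_mem_oBall (H P P (by rwa [dist_self]) hP) h1),
        compl_cB_mem_filter hs0 (notMem_cBall_of_mem_oBall (H P Q hPQ hP) h1)⟩
    refine ⟨ε, hε, fun P Q hPQ => ?_⟩
    by_cases hP : P ∈ cBall a r
    · exact Or.inr (key P Q hPQ hP)
    by_cases hQ : Q ∈ cBall a r
    · exact Or.inr (key Q P (by rwa [dist_comm]) hQ).symm
    exact Or.inl ⟨compl_cB_mem_filter hr0 hP, compl_cB_mem_filter hr0 hQ⟩

variable [Infinite (ResField K)]

/-- Applying `IsAffinoidCover.exists_pairs` to the supremum of the two filters yields one member of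
`C` belonging to both. The case `P = Q` is the Cauchy property, the general case uniform continuity.
-/
theorem exists_pos_forall_coverRel_mem {C : Set (Set (P1 K))} (hC : IsAffinoidCover C) :
    ∃ ε > 0, ∀ P Q : ProjTree K, dist P Q < ε → coverRel C ∈ P.filter ×ˢ Q.filter := by
  obtain ⟨T, hT, hb, H⟩ := hC.exists_pairs
  have : ∀ᶠ ε in 𝓝[>] (0 : ℝ), ∀ p ∈ T, ∀ P Q : ProjTree K, dist P Q < ε →
      p.1 ∈ P.filter ⊔ Q.filter ∨ p.2 ∈ P.filter ⊔ Q.filter := by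
    refine (eventually_all_finite hT).2 fun p hp => ?_
    obtain ⟨h1, h2, h3⟩ := hb p hp
    obtain ⟨ε, hε, h⟩ := exists_pos_forall_mem_sup h1 h2 h3
    filter_upwards [Ioo_mem_nhdsGT hε] with ε' hε' P Q hPQ
    exact h P Q (hPQ.trans hε'.2)
  obtain ⟨ε, h, hε⟩ := (this.and self_mem_nhdsWithin).exists
  exact ⟨ε, hε, fun P Q hPQ => coverRel_mem_prod (H _ fun p hp => h p hp P Q hPQ)⟩

theorem cauchy_filter (P : ProjTree K) : Cauchy P.filter := by
  refine ⟨inferInstance, ?_⟩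
  rintro V ⟨C, hC, hV⟩
  obtain ⟨ε, hε, H⟩ := exists_pos_forall_coverRel_mem hC
  exact mem_of_superset (H P P (by rwa [dist_self])) hV

/-- Given an open ball around `P`, the Cauchy filter `G` must choose between `E`, inside its trace,
and `E'`, whose complement is in `P.filter`. As `G` is coarser, the second choice would make
`P.filter` improper. -/
theorem filter_minimal (P : ProjTree K) {G : Filter (P1 K)} (hG : Cauchy G)
    (h : P.filter ≤ G) : G = P.filter := by
  refine le_antisymm ?_ h
  rw [filter, le_generate_iff]
  rintro _ ⟨D, hD, hP, rfl⟩
  obtain ⟨E, E', h1, h2, h3, h4, h5⟩ := exists_cover_of_mem hD hP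
  rcases Cauchy.mem_or_mem hG h1 h2 h3 with h6 | h6
  · exact mem_of_superset h6 h4
  · exact absurd (inter_mem (h h6) h5) (by
      rw [inter_compl_self]
      exact empty_notMem _)

/-- The map from the projective tree to the compactification of the projective line. -/
def toBer (P : ProjTree K) : Ber K :=
  ⟨⟨P.filter, cauchy_filter P⟩, fun _ hG h => filter_minimal P hG h⟩

end

end ProjTree

/-! ### Bijectivity and uniform continuity of the map to the compactification -/

section

variable {K : Type*} [DenselyNormedField K] [IsUltrametricDist K] [Infinite (ResField K)]

namespace Ber

theorem ext_filter {F G : Ber K} (h : F.filter = G.filter) : F = G := Subtype.ext (Subtype.ext h)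

theorem cauchy (F : Ber K) : Cauchy F.filter := F.1.2

theorem mem_uniformity {V : Set (Ber K × Ber K)} : V ∈ 𝓤 (Ber K) ↔
    ∃ W ∈ 𝓤 (P1 K), {p : Ber K × Ber K | W ∈ p.1.filter ×ˢ p.2.filter} ⊆ V := by
  have : 𝓤 (Ber K) = comap (fun p : Ber K × Ber K => (p.1.1, p.2.1)) (𝓤 (CauchyFilter (P1 K))) :=
    uniformity_comap _
  rw [this, mem_comap]
  constructor
  · rintro ⟨U, hU, h⟩
    obtain ⟨W, hW, hWU⟩ := CauchyFilter.mem_uniformity.1 hU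
    exact ⟨W, hW, fun p hp => h (hWU hp)⟩
  · rintro ⟨W, hW, h⟩
    exact ⟨_, CauchyFilter.mem_uniformity.2 ⟨W, hW, Subset.rfl⟩, h⟩

end Ber

namespace ProjTree

theorem toBer_injective : Function.Injective (toBer : ProjTree K → Ber K) :=
  fun _ _ h => filter_injective (congrArg Ber.filter h)

theorem uniformContinuous_toBer : UniformContinuous (toBer : ProjTree K → Ber K) := by
  intro V hV
  obtain ⟨W, ⟨C, hC, hCW⟩, hWV⟩ := Ber.mem_uniformity.1 hV
  obtain ⟨ε, hε, H⟩ := exists_pos_forall_coverRel_mem hC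
  rw [mem_map]
  refine mem_of_superset (Metric.dist_mem_uniformity hε) fun p hp => hWV ?_
  exact mem_of_superset (H p.1 p.2 hp) hCW

theorem le_infty_filter {F : Filter (P1 K)} (hF : Cauchy F)
    (h : ∀ x r, 0 < r → oB x r ∉ F) : F ≤ (infty : ProjTree K).filter :=
  le_filter_iff.2 ⟨fun _ _ _ h => absurd h infty_notMem_oBall, fun x r hr _ =>
    (Cauchy.oB_mem_or hF x (lt_add_one r) (hr.trans (lt_add_one r))).resolve_left
      (h x _ (hr.trans (lt_add_one r)))⟩

/-- Balls in `F` meet pairwise, so those whose radii approach the infimum `sInf R` form a Cauchy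
sequence in the tree. Their intersection in `K` may be empty; this is why the limit is taken in the
completion. -/
theorem exists_le_of_filter {F : Filter (P1 K)} (hF : Cauchy F) {x₀ : K} {r₀ : ℝ} (hr₀ : 0 < r₀)
    (h₀ : oB x₀ r₀ ∈ F) : ∃ S : KTree K, F ≤ (of S).filter := by
  have := hF.1
  set R : Set ℝ := {r | 0 < r ∧ ∃ x, oB x r ∈ F}
  have hRne : R.Nonempty := ⟨r₀, hr₀, x₀, h₀⟩
  have hRbdd : BddBelow R := ⟨0, fun r hr => hr.1.le⟩
  have hex : ∀ n : ℕ, ∃ r ∈ R, r < sInf R + 1 / ((n : ℝ) + 1) := fun n =>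
    exists_lt_of_csInf_lt hRne (lt_add_of_pos_right _ Nat.one_div_pos_of_nat)
  choose r hrR hr using hex
  have hrd : ∀ n, sInf R ≤ r n := fun n => csInf_le hRbdd (hrR n)
  choose hr0 x hx using hrR
  let T : ℕ → BallTree K := fun n => BallTree.mk (x n) (r n).toNNReal
  have hcoe : ∀ n, ((r n).toNNReal : ℝ) = r n := fun n => Real.coe_toNNReal _ (hr0 n).le
  have hlim : Tendsto (fun n : ℕ => 1 / ((n : ℝ) + 1)) atTop (𝓝 0) :=
    tendsto_one_div_add_atTop_nhds_zero_nat
  have hrlim : Tendsto r atTop (𝓝 (sInf R)) := by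
    refine tendsto_of_tendsto_of_tendsto_of_le_of_le tendsto_const_nhds ?_ hrd
      (fun n => (hr n).le)
    simpa using hlim.const_add (sInf R)
  -- Two balls of `F` have `sup` at most the larger radius, while the mean of their diameters is at
  -- least `sInf R`; the distance is therefore at most `1 / (N + 1)`.
  have hT : CauchySeq (fun n => (T n : KTree K)) := by
    refine cauchySeq_of_le_tendsto_0 _ (fun n m N hn hm => ?_) hlim
    have h1 : BallTree.sup (T n) (T m) ≤ max (r n) (r m) := by
      show max (max ((r n).toNNReal : ℝ) (r m).toNNReal) (dist (x n) (x m)) ≤ _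
      rw [hcoe, hcoe, dist_eq_norm]
      exact max_le le_rfl (norm_sub_lt_of_mem (hx n) (hx m)).le
    have h2 : ∀ k, N ≤ k → r k ≤ sInf R + 1 / ((N : ℝ) + 1) := fun k hk =>
      (hr k).le.trans (add_le_add_right (Nat.one_div_le_one_div hk) _)
    rw [UniformSpace.Completion.dist_eq, BallTree.dist_def]
    have h3 : (T n).diam = r n := hcoe n
    have h4 : (T m).diam = r m := hcoe m
    have h5 := max_le (h2 n hn) (h2 m hm)
    have h6 := hrd n
    have h7 := hrd m
    rw [h3, h4]
    linarith
  obtain ⟨S, hS⟩ := cauchySeq_tendsto_of_complete hT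
  have hsup : ∀ y, Tendsto (fun n => max (r n) ‖y - x n‖) atTop
      (𝓝 (KTree.sup (KTree.ofPoint y) S)) := by
    intro y
    have := (KTree.continuous_sup.tendsto (KTree.ofPoint y, S)).comp
      (tendsto_const_nhds.prodMk_nhds hS)
    refine this.congr fun n => ?_
    show KTree.sup (KTree.ofPoint y) (T n : KTree K) = _
    rw [KTree.sup_ofPoint_coe, hcoe]
  refine ⟨S, le_filter_iff.2 ⟨fun y s _ hys => ?_, fun y s hs hys => ?_⟩⟩
  · obtain ⟨n, hn⟩ := ((hsup y).eventually (gt_mem_nhds (of_mem_oBall.1 hys))).exists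
    refine mem_of_superset (hx n) (image_mono fun z (hz : ‖z - x n‖ < r n) => ?_)
    have := norm_sub_le_max' z (x n) y
    rw [norm_sub_rev (x n)] at this
    exact this.trans_lt ((max_le_max_right _ hz.le).trans_lt hn)
  · rw [of_mem_cBall, not_le] at hys
    obtain ⟨t, hst, htS⟩ := exists_between hys
    -- If the ball of radius `t` around `y` were in `F`, it would meet all the balls of the
    -- sequence, giving `sup {y, S} ≤ max (sInf R) t = t`.
    refine (Cauchy.oB_mem_or hF y hst (hs.trans hst)).resolve_left fun ht => ?_
    have h1 : KTree.sup (KTree.ofPoint y) S ≤ max (sInf R) t := by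
      refine le_of_tendsto_of_tendsto' (hsup y) (hrlim.max tendsto_const_nhds) fun n => ?_
      refine max_le (le_max_left _ _) ?_
      rw [max_comm]
      exact (norm_sub_lt_of_mem ht (hx n)).le
    rw [max_eq_right (csInf_le hRbdd ⟨hs.trans hst, y, ht⟩)] at h1
    exact h1.not_gt htS

theorem toBer_surjective : Function.Surjective (toBer : ProjTree K → Ber K) := by
  intro F
  have hP : ∃ P : ProjTree K, F.filter ≤ P.filter := by
    by_cases h : ∀ x r, 0 < r → oB x r ∉ F.filter
    · exact ⟨_, le_infty_filter F.cauchy h⟩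
    · push Not at h
      obtain ⟨x, r, hr, hx⟩ := h
      obtain ⟨S, hS⟩ := exists_le_of_filter F.cauchy hr hx
      exact ⟨of S, hS⟩
  obtain ⟨P, hP⟩ := hP
  -- A Cauchy filter coarser than `F` suffices, since `F` is minimal.
  exact ⟨P, Ber.ext_filter (F.2 _ (cauchy_filter P) hP)⟩

/-! ### Images of open and closed balls -/

theorem image_toBer_of_isOpenBall {D : Set (ProjTree K)} (hD : IsOpenBall D) :
    toBer '' D = Ber.hat (trace D) := by
  ext F
  obtain ⟨P, rfl⟩ := toBer_surjective F
  rw [toBer_injective.mem_set_image]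
  exact (trace_mem_filter_iff hD).symm

/-- The covering by `E` and `E'` defines the entourage: a set of `P.filter` has a point outside
`E'`, and whatever is close to that point must lie in `E`. -/
theorem isOpen_hat_trace {D : Set (ProjTree K)} (hD : IsOpenBall D) :
    IsOpen (Ber.hat (trace D)) := by
  rw [← image_toBer_of_isOpenBall hD, isOpen_uniformity]
  rintro _ ⟨P, hP, rfl⟩
  obtain ⟨E, E', h1, h2, h3, h4, h5⟩ := exists_cover_of_mem hD hP
  refine Ber.mem_uniformity.2 ⟨_, mem_uniformity_P1.2 ⟨_, isAffinoidCover_pair h1 h2 h3,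
    Subset.rfl⟩, ?_⟩
  rintro ⟨F, G⟩ hFG (rfl : F = _)
  obtain ⟨A, hA, B, hB, hAB⟩ := mem_prod_iff.1 hFG
  obtain ⟨a, ha, haE⟩ := Filter.nonempty_of_mem (inter_mem (f := P.filter) hA h5)
  rw [image_toBer_of_isOpenBall hD]
  refine mem_of_superset hB fun b hb => h4 ?_
  obtain ⟨Y, hY, haY, hbY⟩ := mem_iUnion₂.1 (hAB (mk_mem_prod ha hb))
  rcases hY with rfl | rfl
  · exact hbY
  · exact absurd haY haE

/-- The image is the complement of the open set attached to `Dᶜ`, hence closed. A filter `F` in it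
does not contain the trace of `Dᶜ`, so every set of `F` meets the trace of `D`; small sets of `F`
then give points of the trace arbitrarily close to `F`. -/
theorem image_toBer_of_isClosedBall {D : Set (ProjTree K)} (hD : IsClosedBall D) :
    toBer '' D = Ber.cl (trace D) := by
  have hDc := isOpenBall_compl_iff.2 hD
  have himg : toBer '' D = (Ber.hat (trace Dᶜ))ᶜ := by
    rw [← image_toBer_of_isOpenBall hDc,
      image_compl_eq ⟨toBer_injective, toBer_surjective⟩, compl_compl]
  rw [himg]
  refine Subset.antisymm ?_ ?_
  · intro F hF
    refine UniformSpace.mem_closure_iff_ball.2 fun {V} hV => ?_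
    obtain ⟨W, hW, hWV⟩ := Ber.mem_uniformity.1 hV
    obtain ⟨W', hW', hW'W⟩ := comp_mem_uniformity_sets hW
    obtain ⟨A, hA, hAW⟩ := (cauchy_iff.1 F.cauchy).2 W' hW'
    obtain ⟨y, hyA, hyD⟩ : (A ∩ trace D).Nonempty := by
      by_contra hne
      refine hF (mem_of_superset hA fun y hy => ?_)
      rw [trace_compl]
      exact fun hyD => hne ⟨y, hy, hyD⟩
    refine ⟨P1.toBer y, hWV (mem_of_superset (prod_mem_prod hA
      (UniformSpace.ball_mem_nhds y hW')) ?_), mem_image_of_mem _ hyD⟩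
    rintro ⟨a, b⟩ ⟨ha, hb⟩
    exact hW'W ⟨y, hAW (mk_mem_prod ha hyA), hb⟩
  · refine closure_minimal ?_ (isOpen_hat_trace hDc).isClosed_compl
    rintro _ ⟨y, hy, rfl⟩ hmem
    rw [trace_compl] at hmem
    exact mem_of_mem_nhds (x := y) hmem hy

/-! ### The ball of a point -/

/-- The balls around points `a` with `sup {a, S}` near `diam S` cut the intersection down to this
set. Conversely, its elements are centers of `S`, hence lie in every ball of `K` that belongs to the
filter. The set is empty when no point of `K` attains `diam S`. -/
theorem ball_toBer_of (S : KTree K) :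
    (of S).toBer.ball = {w | KTree.sup (KTree.ofPoint w) S ≤ KTree.diam S} := by
  have hd0 : ∀ x : K, 0 ≤ KTree.sup (KTree.ofPoint x) S := fun x => sup_nonneg _ _
  ext w
  constructor
  · intro hw
    rw [mem_ofPred_eq]
    refine le_of_forall_gt fun r hr => ?_
    obtain ⟨a, ha⟩ := KTree.exists_sup_ofPoint_lt S hr
    have hr0 := (hd0 a).trans_lt ha
    have h1 : ‖w - a‖ < r :=
      hw {z | ‖z - a‖ < r} ⟨isBallK_lt a hr0, oB_mem_filter hr0 (of_mem_oBall.2 ha)⟩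
    exact (KTree.sup_ofPoint_ultra w a S).trans_lt (max_lt h1 ha)
  · rintro (hw : KTree.sup _ S ≤ _) B ⟨hB, hBF⟩
    have hle : ∀ x, ‖w - x‖ ≤ KTree.sup (KTree.ofPoint x) S := fun x =>
      (KTree.norm_sub_le_sup w x S).trans
        (max_le (hw.trans (KTree.diam_le_sup' _ _)) le_rfl)
    have hcl : ∀ x r, 0 < r → cB x r ∈ (of S).filter → ‖w - x‖ ≤ r := by
      intro x r hr h
      refine (hle x).trans (le_of_forall_gt fun s hs => ?_)
      exact of_mem_oBall.1 ((oB_mem_filter_iff (hr.trans hs)).1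
        (mem_of_superset h (cB_subset_oB x hs)))
    rcases hB with ⟨x, r, hr, rfl⟩ | ⟨x, r, hr, rfl⟩ | ⟨x, r, hr, -, rfl⟩
    · exact (hle x).trans_lt (of_mem_oBall.1 ((oB_mem_filter_iff (valueGroup_pos hr)).1 hBF))
    · exact hcl x r (valueGroup_pos hr) hBF
    · exact hcl x r hr hBF

theorem ball_toBer_infty : (infty : ProjTree K).toBer.ball = univ := by
  refine eq_univ_of_forall fun w => ?_
  rintro B ⟨-, hB⟩
  exact absurd (pure_infty_le_filter hB) infty_notMem_image

theorem ball_toBer_mk (a : K) (r : ℝ≥0) :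
    (of (BallTree.mk a r : KTree K)).toBer.ball = {w | ‖w - a‖ ≤ r} := by
  rw [ball_toBer_of]
  ext w
  rw [mem_ofPred_eq, KTree.sup_ofPoint_coe, KTree.diam_mk]
  exact max_le_iff.trans (and_iff_right le_rfl)

theorem ball_toBer_ofBall (S : BallTree K) : (ofBall S).toBer.ball = S.ball := by
  induction S using Quotient.ind with
  | _ p =>
    refine (ball_toBer_mk p.1 p.2).trans ?_
    simp only [← dist_eq_norm]
    rfl

/-- A center `a` of `S` lies in the ball of `F`, so `F` comes from some `[a, r']`, and density of
the value group lets the ball determine its radius. Infinity is excluded because its ball is all of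
`K`, which is unbounded. -/
theorem eq_toBer_of_ball_eq {S : BallTree K} (hS : S ∉ Set.range BallTree.ofPoint) {F : Ber K}
    (h : F.ball = S.ball) : F = (ofBall S).toBer := by
  obtain ⟨P, rfl⟩ := toBer_surjective F
  rw [← ball_toBer_ofBall] at h
  induction S using Quotient.ind with
  | _ p =>
    obtain ⟨a, r⟩ := p
    change BallTree.mk a r ∉ _ at hS
    have hr : 0 < r := by
      refine pos_iff_ne_zero.2 ?_
      rintro rfl
      exact hS ⟨a, rfl⟩
    change _ = (of (BallTree.mk a r : KTree K)).toBer.ball at h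
    change P.toBer = (of (BallTree.mk a r : KTree K)).toBer
    rw [ball_toBer_mk] at h
    rcases P with T | _
    · have ha : a ∈ (of T).toBer.ball := by
        rw [h, mem_ofPred_eq, sub_self, norm_zero]
        exact r.coe_nonneg
      rw [ball_toBer_of] at ha
      rw [KTree.eq_mk_of_sup_eq_diam (le_antisymm ha (KTree.diam_le_sup' _ _))] at h ⊢
      rw [ball_toBer_mk] at h
      have h1 := le_of_ball_subset (NNReal.coe_pos.2 hr) h.ge
      have h2 := le_of_ball_subset ((NNReal.coe_pos.2 hr).trans_le h1) h.le
      rw [NNReal.coe_injective (le_antisymm h2 h1)]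
    · rw [ball_toBer_infty] at h
      obtain ⟨z, hz⟩ := NormedField.exists_lt_norm K r
      have : a + z ∈ {w : K | ‖w - a‖ ≤ r} := h ▸ mem_univ _
      rw [mem_ofPred_eq, add_sub_cancel_left] at this
      exact absurd this hz.not_ge

end ProjTree

end

end BerkLine

end

theorem mainTheorem1 {K : Type*} [DenselyNormedField K] [IsUltrametricDist K]
    [CompleteSpace K] [Infinite (ResField K)] :
    (∀ S : BallTree K, S ∉ Set.range BallTree.ofPoint → ∃! F : Ber K, F.ball = S.ball) ∧
    ∃ ι : ProjTree K → Ber K,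
      (∀ S : BallTree K, S ∉ Set.range BallTree.ofPoint →
        (ι (ProjTree.ofBall S)).ball = S.ball) ∧
      Function.Bijective ι ∧ UniformContinuous ι ∧
      (∀ B : Set (P1 K), IsOpenBall B ∨ IsIrrationalBall B →
        ∃! D : Set (ProjTree K), ProjTree.IsOpenBall D ∧ ProjTree.trace D = B) ∧
      (∀ D : Set (ProjTree K), ProjTree.IsOpenBall D →
        (IsOpenBall (ProjTree.trace D) ∨ IsIrrationalBall (ProjTree.trace D)) ∧
          ι '' D = Ber.hat (ProjTree.trace D)) ∧
      (∀ B : Set (P1 K), IsClosedBall B ∨ IsIrrationalBall B →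
        ∃! D : Set (ProjTree K), ProjTree.IsClosedBall D ∧ ProjTree.trace D = B) ∧
      (∀ D : Set (ProjTree K), ProjTree.IsClosedBall D →
        (IsClosedBall (ProjTree.trace D) ∨ IsIrrationalBall (ProjTree.trace D)) ∧
          ι '' D = Ber.cl (ProjTree.trace D)) := by
  refine ⟨fun S hS => ⟨_, ProjTree.ball_toBer_ofBall S,
      fun F hF => ProjTree.eq_toBer_of_ball_eq hS hF⟩,
    ProjTree.toBer, fun S _ => ProjTree.ball_toBer_ofBall S,
    ⟨ProjTree.toBer_injective, ProjTree.toBer_surjective⟩, ProjTree.uniformContinuous_toBer,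
    fun B hB => ?_, fun D hD => ⟨?_, ProjTree.image_toBer_of_isOpenBall hD⟩,
    fun B hB => ?_, fun D hD => ⟨?_, ProjTree.image_toBer_of_isClosedBall hD⟩⟩
  · obtain ⟨D, hD, rfl⟩ := ProjTree.isOpenBall_or_isIrrationalBall_iff.1 hB
    exact ⟨D, ⟨hD, rfl⟩, fun D' h => ProjTree.eq_of_trace_eq h.1 hD h.2⟩
  · exact ProjTree.isOpenBall_or_isIrrationalBall_iff.2 ⟨D, hD, rfl⟩
  · obtain ⟨D, hD, rfl⟩ := ProjTree.isClosedBall_or_isIrrationalBall_iff.1 hB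
    refine ⟨D, ⟨hD, rfl⟩, fun D' h => compl_injective ?_⟩
    refine ProjTree.eq_of_trace_eq (ProjTree.isOpenBall_compl_iff.2 h.1)
      (ProjTree.isOpenBall_compl_iff.2 hD) ?_
    rw [ProjTree.trace_compl, ProjTree.trace_compl, h.2]
  · exact ProjTree.isClosedBall_or_isIrrationalBall_iff.2 ⟨D, hD, rfl⟩
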